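/- Let $\alpha,\beta\in\mathbb C$ and let $p,q$ be meromorphic functions on $\mathbb C$ solving the Hamiltonian system $$p'=-q^2-zp-\alpha,\qquad q'=p^2+zq+\beta .$$ For a meromorphic function $f$ on $\mathbb C$ and $\kappa\in\mathbb C\setminus\{0\}$ put $f_\kappa(\zeta)=\kappa^{-1}f(\kappa+\kappa^{-1}\zeta)$. A limit function of $f$ is a function $\mathfrak f=\lim_{n\to\infty}f_{\kappa_n}$ with $\kappa_n\to\infty$, where the convergence is uniform on compact subsets of $\mathbb C$ with respect to the chordal metric of the Riemann sphere. The class $\overline{\mathfrak Y}_{1,1}$ consists of all meromorphic functions $f$ on $\mathbb C$ such that (i) the family $(f_\kappa)_{|\kappa|>1}$ is normal on $\mathbb C$ in the sense of Montel, (ii) no limit function of $f$ is identically $\infty$, and (iii) at least one limit function of $f$ is non-constant. Then: (a) $p$ and $q$ satisfy (i) and (ii). If $p$ and $q$ are not both rational functions, then they also satisfy (iii), so that $p,q\in\overline{\mathfrak Y}_{1,1}$. (b) Whenever $\kappa_n\to\infty$ and both limits $\mathfrak p=\lim_{n\to\infty}p_{\kappa_n}$ and $\mathfrak q=\lim_{n\to\infty}q_{\kappa_n}$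 exist (locally uniformly in the chordal metric), $\mathfrak p$ and $\mathfrak q$ are meromorphic functions on $\mathbb C$ and there is a constant $\mathfrak c\in\mathbb C$, depending on $(\kappa_n)$, such that $$\mathfrak p'=-\mathfrak q^2-\mathfrak p,\qquad \mathfrak q'=\mathfrak p^2+\mathfrak q,\qquad \tfrac13(\mathfrak p^3+\mathfrak q^3)+\mathfrak p\mathfrak q=\mathfrak c .$$ -/

import Mathlib

open Filter Topology Complex

open scoped OnePoint

noncomputable section

/-- The Riemann-sphere value at `z` of a meromorphic function `f` on the plane: `∞` at a pole, and
elsewhere the value at `z` of the analytic function that coincides with `f` near `z` (apart from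
`z` itself). In particular the value assigned by `f` to a pole or a removable singularity is
irrelevant. -/
def sphereValue (f : ℂ → ℂ) (z : ℂ) : OnePoint ℂ :=
  open Classical in
  if meromorphicOrderAt f z < 0 then ∞ else ((toMeromorphicNFAt f z z : ℂ) : OnePoint ℂ)

/-- The chordal distance on the Riemann sphere. -/
def chordalDist : OnePoint ℂ → OnePoint ℂ → ℝ
  | OnePoint.infty, OnePoint.infty => 0
  | OnePoint.infty, OnePoint.some w => 2 / √(1 + ‖w‖ ^ 2)
  | OnePoint.some z, OnePoint.infty => 2 / √(1 + ‖z‖ ^ 2)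
  | OnePoint.some z, OnePoint.some w => 2 * ‖z - w‖ / (√(1 + ‖z‖ ^ 2) * √(1 + ‖w‖ ^ 2))

/-- The sequence `F` of sphere-valued functions on the plane converges to `G`, uniformly on compact
sets with respect to the chordal metric. -/
def SphericallyTendsto (F : ℕ → ℂ → OnePoint ℂ) (G : ℂ → OnePoint ℂ) : Prop :=
  ∀ K : Set ℂ, IsCompact K → ∀ ε : ℝ, 0 < ε →
    ∀ᶠ n in atTop, ∀ z ∈ K, chordalDist (F n z) (G z) < ε

/-- Normality on the plane in the sense of Montel of a family of meromorphic functions: every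
sequence in the family has a subsequence which converges, uniformly on compact sets with respect to
the chordal metric (the limit `∞` being admitted). -/
def IsNormalFamily (𝓕 : Set (ℂ → ℂ)) : Prop :=
  ∀ f : ℕ → ℂ → ℂ, (∀ n, f n ∈ 𝓕) →
    ∃ φ : ℕ → ℕ, StrictMono φ ∧
      ∃ G : ℂ → OnePoint ℂ, SphericallyTendsto (fun n => sphereValue (f (φ n))) G

/-- The rescaled function `ζ ↦ κ⁻ᵃ f (κ + κ⁻ᵇ ζ)` (principal branch of the powers). -/
def rescale (a b : ℝ) (f : ℂ → ℂ) (κ : ℂ) (ζ : ℂ) : ℂ :=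
  κ ^ (-(a : ℂ)) * f (κ + κ ^ (-(b : ℂ)) * ζ)

/-- `G` is the limit of the rescaled functions along the sequence `κ`. -/
def IsRescaledLimit (a b : ℝ) (f : ℂ → ℂ) (κ : ℕ → ℂ) (G : ℂ → OnePoint ℂ) : Prop :=
  SphericallyTendsto (fun n => sphereValue (rescale a b f (κ n))) G

/-- `f` is meromorphic, the family of its rescalings with `|κ| > 1` is normal on the plane, and no
limit function for `κ → ∞` is identically `∞`. -/
structure IsYosidaNormal (a b : ℝ) (f : ℂ → ℂ) : Prop where
  meromorphic : Meromorphic f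
  normal : IsNormalFamily {g | ∃ κ : ℂ, 1 < ‖κ‖ ∧ g = rescale a b f κ}
  limit_ne_infty : ∀ (κ : ℕ → ℂ) (G : ℂ → OnePoint ℂ), Tendsto (fun n => ‖κ n‖) atTop atTop →
    IsRescaledLimit a b f κ G → ∃ ζ, G ζ ≠ ∞

/-- The class `Ȳ_{a,b}`: in addition, at least one limit function for `κ → ∞` is not constant. -/
structure IsYosidaBar (a b : ℝ) (f : ℂ → ℂ) : Prop extends IsYosidaNormal a b f where
  exists_nonconstant : ∃ (κ : ℕ → ℂ) (G : ℂ → OnePoint ℂ), Tendsto (fun n => ‖κ n‖) atTop atTop ∧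
    IsRescaledLimit a b f κ G ∧ ∃ ζ₁ ζ₂, G ζ₁ ≠ G ζ₂

/-- `p`, `q` are meromorphic functions on the plane that solve `p' = -q² - zp - α`,
`q' = p² + zq + β`. The equations are identities between meromorphic functions, that is, they
hold off a closed discrete set. -/
structure IsHamiltonianSolution (α β : ℂ) (p q : ℂ → ℂ) : Prop where
  meromorphic_left : Meromorphic p
  meromorphic_right : Meromorphic q
  deriv_left : deriv p =ᶠ[codiscrete ℂ] fun z => -q z ^ 2 - z * p z - α
  deriv_right : deriv q =ᶠ[codiscrete ℂ] fun z => p z ^ 2 + z * q z + β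

/-- `P`, `Q` are meromorphic functions on the plane that solve the autonomous system
`P' = -Q² - P`, `Q' = P² + Q`, `(P³ + Q³)/3 + PQ = c`. -/
structure IsLimitSolution (c : ℂ) (P Q : ℂ → ℂ) : Prop where
  meromorphic_left : Meromorphic P
  meromorphic_right : Meromorphic Q
  deriv_left : deriv P =ᶠ[codiscrete ℂ] fun z => -Q z ^ 2 - P z
  deriv_right : deriv Q =ᶠ[codiscrete ℂ] fun z => P z ^ 2 + Q z
  first_integral : (fun z => (P z ^ 3 + Q z ^ 3) / 3 + P z * Q z) =ᶠ[codiscrete ℂ] fun _ => c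

/-- `f` is, as a meromorphic function, a rational function. -/
def IsRationalFunction (f : ℂ → ℂ) : Prop :=
  ∃ A B : Polynomial ℂ, B ≠ 0 ∧ f =ᶠ[codiscrete ℂ] fun z => A.eval z / B.eval z

end

/-! Everything rests on a growth estimate for the Hamiltonian `H = (p³ + q³)/3 + zpq + αq + βp`.
Along a solution `H' = pq`, which is not integrable through poles. The correction `q²/p` removes the
polar part: using the cubic relation between `p`, `q` and `H`, the main term of its derivative is
again `pq`. Since `1/p` is itself singular at the zeros of `p`, it is replaced by the smooth
quantity `conj p / (S² + |p|²)`, at the price of holomorphy; differentiation therefore takes place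
along real segments only. For the resulting `W` a bootstrap holds: as long as `|W| ≤ S³`, one has
`|W'| ≤ 2300 S²` (`exists_hasDerivAt_modHamiltonian`). With `S = L(1 + |z|)` and `L` large,
integration from a fixed base point to `z` changes `W` by at most `S³/2`, so `|W| ≤ S³` off a
countable set (`exists_norm_modHamiltonian_le`).

This bound and the cubic relation make `|p|` and `|q|` comparable whenever either is large against
`S`. Hence `|p'|` is `O(S² + |p|²)`, and `|p|² ≤ 2|p'|` for `|p|` large against `S`; likewise for
`q` (`HasYosidaBound`). The upper bound says that the rescaled functions have locally bounded
spherical derivative, and normality follows from Arzelà–Ascoli. The lower bound says that the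
reciprocal of a rescaled function has derivative at least `1/2` in modulus where it is small, so by
Cauchy's estimate it cannot tend to `0`: the limit `∞` is excluded.

Limits of the rescaled pair inherit the differential equations off a countable set, then everywhere
off the poles by continuity. The first integral has zero derivative on the connected complement of
the poles, so it is constant.

If all limits of `p` were constant, then along a subsequence `p → c`, the limit of `q` would satisfy
`Q² = -c`, and no limit of `p` or `q` would have a pole. A compactness argument then gives linear
growth and no poles near infinity, so both functions are rational
(`IsYosidaNormal.isRationalFunction`). -/

open scoped ComplexConjugate

/-! ### Stereographic coordinates for the chordal metric. -/

/-- Stereographic projection of the Riemann sphere, with the point at infinity as north pole. -/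
noncomputable def stereo (x : OnePoint ℂ) : ℂ × ℝ :=
  x.elim (0, 1) fun w => (((2 / (1 + ‖w‖ ^ 2) : ℝ) : ℂ) * w, 1 - 2 / (1 + ‖w‖ ^ 2))

@[simp] lemma stereo_infty : stereo ∞ = (0, 1) := rfl

@[simp] lemma stereo_coe (w : ℂ) :
    stereo w = (((2 / (1 + ‖w‖ ^ 2) : ℝ) : ℂ) * w, 1 - 2 / (1 + ‖w‖ ^ 2)) := rfl

lemma chordalDist_nonneg (x y : OnePoint ℂ) : 0 ≤ chordalDist x y := by
  induction x using OnePoint.rec <;> induction y using OnePoint.rec <;>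
    simp only [chordalDist] <;> positivity

lemma norm_add_sq_stereo_infty (w : ℂ) :
    ‖((2 / (1 + ‖w‖ ^ 2) : ℝ) : ℂ) * w‖ ^ 2 + (2 / (1 + ‖w‖ ^ 2)) ^ 2
      = (2 / √(1 + ‖w‖ ^ 2)) ^ 2 := by
  have hA : 0 < 1 + ‖w‖ ^ 2 := by positivity
  rw [norm_mul, Complex.norm_real, Real.norm_of_nonneg (by positivity), div_pow _ (√_),
    Real.sq_sqrt hA.le]
  field_simp
  ring

lemma chordalDist_sq (x y : OnePoint ℂ) : chordalDist x y ^ 2 =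
    ‖(stereo x - stereo y).1‖ ^ 2 + ‖(stereo x - stereo y).2‖ ^ 2 := by
  induction x using OnePoint.rec with
  | infty =>
    induction y using OnePoint.rec with
    | infty => simp [chordalDist]
    | coe w =>
      have := norm_add_sq_stereo_infty w
      simp only [chordalDist, stereo_infty, stereo_coe, Prod.fst_sub, Prod.snd_sub, zero_sub,
        norm_neg, sub_sub_cancel, Real.norm_eq_abs, sq_abs]
      exact this.symm
  | coe z =>
    induction y using OnePoint.rec with
    | infty =>
      have := norm_add_sq_stereo_infty z
      simp only [chordalDist, stereo_infty, stereo_coe, Prod.fst_sub, Prod.snd_sub, sub_zero,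
        sub_sub_cancel_left, norm_neg, Real.norm_eq_abs, sq_abs]
      exact this.symm
    | coe w =>
      simp only [chordalDist, stereo_coe, Prod.fst_sub, Prod.snd_sub, Real.norm_eq_abs, sq_abs,
        div_pow, mul_pow]
      rw [Real.sq_sqrt (by positivity), Real.sq_sqrt (by positivity)]
      have hA : 0 < 1 + ‖z‖ ^ 2 := by positivity
      have hB : 0 < 1 + ‖w‖ ^ 2 := by positivity
      simp only [← Complex.normSq_eq_norm_sq] at *
      have hA' := hA.ne'
      have hB' := hB.ne'
      simp only [Complex.normSq_apply, Complex.sub_re, Complex.sub_im, Complex.re_ofReal_mul,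
        Complex.im_ofReal_mul] at *
      field_simp
      ring

/-- The norm on `ℂ × ℝ` is the maximum norm while the chordal distance is Euclidean; the two are
only equivalent. With `chordalDist_le` this turns chordal convergence into uniform convergence in a
normed space. -/
lemma norm_stereo_sub_le (x y : OnePoint ℂ) : ‖stereo x - stereo y‖ ≤ chordalDist x y := by
  have h := chordalDist_sq x y
  rw [Prod.norm_def, max_le_iff]
  constructor <;> refine abs_le_of_sq_le_sq' ?_ (chordalDist_nonneg x y) |>.2 <;>
    nlinarith [sq_nonneg ‖(stereo x - stereo y).1‖, sq_nonneg ‖(stereo x - stereo y).2‖]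

lemma chordalDist_le (x y : OnePoint ℂ) : chordalDist x y ≤ 2 * ‖stereo x - stereo y‖ := by
  have h := chordalDist_sq x y
  have h1 : ‖(stereo x - stereo y).1‖ ≤ ‖stereo x - stereo y‖ := norm_fst_le _
  have h2 : ‖(stereo x - stereo y).2‖ ≤ ‖stereo x - stereo y‖ := norm_snd_le _
  refine abs_le_of_sq_le_sq' ?_ (by positivity) |>.2
  nlinarith [norm_nonneg (stereo x - stereo y).1, norm_nonneg (stereo x - stereo y).2]

lemma stereo_injective : Function.Injective stereo := by
  intro x y h
  have h0 : chordalDist x y = 0 := by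
    have := chordalDist_sq x y
    simpa [h] using this
  induction x using OnePoint.rec with
  | infty =>
    induction y using OnePoint.rec with
    | infty => rfl
    | coe w =>
      have : 0 < 2 / √(1 + ‖w‖ ^ 2) := by positivity
      simp only [chordalDist] at h0; linarith
  | coe z =>
    induction y using OnePoint.rec with
    | infty =>
      have : 0 < 2 / √(1 + ‖z‖ ^ 2) := by positivity
      simp only [chordalDist] at h0; linarith
    | coe w =>
      simp only [chordalDist] at h0
      have h1 : √(1 + ‖z‖ ^ 2) ≠ 0 := by positivity
      have h2 : √(1 + ‖w‖ ^ 2) ≠ 0 := by positivity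
      simp [h1, h2, sub_eq_zero] at h0
      simp [h0]

lemma tendsto_coe_infty_cobounded :
    Tendsto ((↑) : ℂ → OnePoint ℂ) (Bornology.cobounded ℂ) (𝓝 ∞) := by
  rw [Metric.cobounded_eq_cocompact, ← coclosedCompact_eq_cocompact]
  exact OnePoint.tendsto_coe_infty

lemma continuous_stereo : Continuous stereo := by
  rw [OnePoint.continuous_iff, coclosedCompact_eq_cocompact, ← Metric.cobounded_eq_cocompact]
  constructor
  · have h1 : Tendsto (fun w : ℂ => 2 / √(1 + ‖w‖ ^ 2)) (Bornology.cobounded ℂ) (𝓝 0) := by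
      refine Tendsto.const_div_atTop ?_ _
      refine tendsto_atTop_mono (fun w => ?_) (tendsto_norm_cobounded_atTop (E := ℂ))
      exact Real.le_sqrt_of_sq_le (by simp)
    rw [tendsto_iff_norm_sub_tendsto_zero]
    exact squeeze_zero (fun _ => norm_nonneg _) (fun w => norm_stereo_sub_le w ∞) h1
  · simp only [stereo_coe]
    have : ∀ w : ℂ, 1 + ‖w‖ ^ 2 ≠ 0 := fun w => by positivity
    fun_prop (disch := first | assumption | (intro; positivity) | positivity)

lemma isClosedEmbedding_stereo : IsClosedEmbedding stereo :=
  continuous_stereo.isClosedEmbedding stereo_injective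

lemma sphericallyTendsto_iff {F : ℕ → ℂ → OnePoint ℂ} {G : ℂ → OnePoint ℂ} :
    SphericallyTendsto F G ↔
      TendstoLocallyUniformly (fun n z => stereo (F n z)) (fun z => stereo (G z)) atTop := by
  rw [tendstoLocallyUniformly_iff_forall_isCompact]
  simp only [Metric.tendstoUniformlyOn_iff]
  refine forall₂_congr fun K _ => ⟨fun h ε hε => ?_, fun h ε hε => ?_⟩
  · filter_upwards [h ε hε] with n hn z hz
    rw [dist_comm, dist_eq_norm]
    exact (norm_stereo_sub_le _ _).trans_lt (hn z hz)
  · filter_upwards [h (ε / 2) (half_pos hε)] with n hn z hz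
    have h1 := hn z hz
    rw [dist_comm, dist_eq_norm] at h1
    linarith [chordalDist_le (F n z) (G z)]

/-! ### Sphere values of meromorphic functions. -/

/-- The finite part of a point of the Riemann sphere, with value `0` at infinity. -/
def finPart (x : OnePoint ℂ) : ℂ := x.elim 0 id

@[simp] lemma finPart_coe (w : ℂ) : finPart w = w := rfl

lemma coe_finPart {x : OnePoint ℂ} (hx : x ≠ ∞) : (finPart x : OnePoint ℂ) = x := by
  obtain ⟨w, rfl⟩ := OnePoint.ne_infty_iff_exists.1 hx
  rfl

lemma tendsto_sphereValue {f : ℂ → ℂ} {z : ℂ} (hf : MeromorphicAt f z) :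
    Tendsto (fun w => (f w : OnePoint ℂ)) (𝓝[≠] z) (𝓝 (sphereValue f z)) := by
  unfold sphereValue
  split_ifs with h
  · exact tendsto_coe_infty_cobounded.comp (tendsto_cobounded_of_meromorphicOrderAt_neg h)
  · have h1 := (hf.meromorphicOrderAt_nonneg_iff_analyticAt_toMeromorphicNFAt).1 (not_lt.1 h)
    have h2 : Tendsto (toMeromorphicNFAt f z) (𝓝[≠] z) (𝓝 (toMeromorphicNFAt f z z)) :=
      h1.continuousAt.tendsto.mono_left nhdsWithin_le_nhds
    exact (OnePoint.continuous_coe.tendsto _).comp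
      (h2.congr' hf.eq_nhdsNE_toMeromorphicNFAt.symm)

lemma sphereValue_eq_of_tendsto {f : ℂ → ℂ} {z : ℂ} {x : OnePoint ℂ} (hf : MeromorphicAt f z)
    (h : Tendsto (fun w => (f w : OnePoint ℂ)) (𝓝[≠] z) (𝓝 x)) : sphereValue f z = x :=
  tendsto_nhds_unique (tendsto_sphereValue hf) h

lemma sphereValue_of_continuousAt {f : ℂ → ℂ} {z : ℂ} (hf : MeromorphicAt f z)
    (h : ContinuousAt f z) : sphereValue f z = f z :=
  sphereValue_eq_of_tendsto hf
    ((OnePoint.continuous_coe.tendsto _).comp (h.tendsto.mono_left nhdsWithin_le_nhds))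

lemma sphereValue_of_analyticAt {f : ℂ → ℂ} {z : ℂ} (hf : AnalyticAt ℂ f z) :
    sphereValue f z = f z := sphereValue_of_continuousAt hf.meromorphicAt hf.continuousAt

lemma sphereValue_congr {f g : ℂ → ℂ} {z : ℂ} (hf : MeromorphicAt f z) (h : f =ᶠ[𝓝[≠] z] g) :
    sphereValue f z = sphereValue g z := by
  symm
  refine sphereValue_eq_of_tendsto (hf.congr h) ((tendsto_sphereValue hf).congr' ?_)
  filter_upwards [h] with w hw
  rw [hw]

lemma eventually_sphereValue_eq {f : ℂ → ℂ} {z : ℂ} (hf : MeromorphicAt f z) :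
    ∀ᶠ w in 𝓝[≠] z, sphereValue f w = f w := by
  filter_upwards [hf.eventually_analyticAt] with w hw using sphereValue_of_analyticAt hw

lemma continuous_sphereValue {f : ℂ → ℂ} (hf : Meromorphic f) : Continuous (sphereValue f) := by
  rw [continuous_iff_continuousAt]
  intro z
  rw [continuousAt_iff_punctured_nhds]
  refine (tendsto_sphereValue (hf z)).congr' ?_
  filter_upwards [eventually_sphereValue_eq (hf z)] with w hw using hw.symm

lemma analyticAt_finPart_sphereValue {f : ℂ → ℂ} {z : ℂ} (hf : MeromorphicAt f z)
    (hz : sphereValue f z ≠ ∞) : AnalyticAt ℂ (fun w => finPart (sphereValue f w)) z := by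
  have h : ¬ meromorphicOrderAt f z < 0 := by
    intro h; exact hz (by simp [sphereValue, h])
  have h1 := (hf.meromorphicOrderAt_nonneg_iff_analyticAt_toMeromorphicNFAt).1 (not_lt.1 h)
  refine h1.congr ?_
  have h2 : ∀ᶠ w in 𝓝[≠] z, toMeromorphicNFAt f z w = finPart (sphereValue f w) := by
    filter_upwards [eventually_sphereValue_eq hf, hf.eq_nhdsNE_toMeromorphicNFAt] with w hw hw'
    rw [hw, ← hw', finPart_coe]
  refine eventuallyEq_nhds_of_eventuallyEq_nhdsNE h2 ?_
  simp [sphereValue, h]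

/-! ### Countable exceptional sets, spherical derivatives and normality. -/

lemma exists_countable_compl_of_mem_codiscrete {S : Set ℂ} (hS : S ∈ codiscrete ℂ) :
    IsOpen S ∧ Sᶜ.Countable := by
  rw [mem_codiscrete'] at hS
  refine ⟨hS.1, ?_⟩
  have := hS.2.to_subtype
  exact Set.countable_coe_iff.1 (TopologicalSpace.separableSpace_iff_countable.1 inferInstance)

lemma dense_compl_of_countable {D : Set ℂ} (hD : D.Countable) : Dense Dᶜ :=
  hD.dense_compl ℝ

/-- From a point off a countable set, almost every other point is visible along a segment. -/
lemma dense_setOf_segment_avoids {D : Set ℂ} (hD : D.Countable) {a : ℂ} (ha : a ∉ D) :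
    Dense {b : ℂ | ∀ t ∈ Set.Icc (0 : ℝ) 1, a + t * (b - a) ∉ D} := by
  -- The segment from `a` to `b` can meet `d` only if `b` lies on the real line through `a` and `d`,
  -- which is a null set; countably many such lines are still null.
  have h : ∀ d ∈ D, ∀ᵐ b : ℂ, b ∉ line[ℝ, a, d] := by
    intro d _
    refine (MeasureTheory.measure_eq_zero_iff_ae_notMem).1
      (MeasureTheory.Measure.addHaar_affineSubspace _ _ fun htop => ?_)
    have h1 : (line[ℝ, a, d]).direction = ⊤ := by rw [htop, AffineSubspace.direction_top]
    rw [direction_affineSpan, vectorSpan_pair_rev] at h1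
    have h2 := finrank_span_le_card (R := ℝ) ({d -ᵥ a} : Set ℂ)
    rw [h1, finrank_top, Complex.finrank_real_complex] at h2
    simp at h2
  refine MeasureTheory.Measure.dense_of_ae (μ := MeasureTheory.volume) ?_
  filter_upwards [(MeasureTheory.ae_ball_iff hD).2 h] with b hb t ht htD
  rcases eq_or_ne t 0 with rfl | ht0
  · simp at htD; exact ha htD
  · refine hb _ htD ?_
    have : b = AffineMap.lineMap a (a + t * (b - a)) (t⁻¹ : ℝ) := by
      rw [AffineMap.lineMap_apply]
      simp only [vsub_eq_sub, add_sub_cancel_left, vadd_eq_add, Complex.real_smul]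
      push_cast
      have : (t : ℂ) ≠ 0 := by exact_mod_cast ht0
      field_simp
      ring
    have hm := AffineMap.lineMap_mem_affineSpan_pair (t⁻¹ : ℝ) a (a + t * (b - a))
    rwa [← this] at hm

lemma exists_hasDerivAt_stereo {γ : ℝ → ℂ} {γ' : ℂ} {t : ℝ} (h : HasDerivAt γ γ' t) :
    ∃ v, HasDerivAt (fun s => stereo (γ s)) v t ∧ ‖v‖ ≤ 6 * (‖γ'‖ / (1 + ‖γ t‖ ^ 2)) := by
  set N := 1 + ‖γ t‖ ^ 2 with hN
  have hN0 : 0 < N := by positivity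
  have h1 : HasDerivAt (fun s => 1 + ‖γ s‖ ^ 2) (2 * inner ℝ (γ t) γ') t := h.norm_sq.const_add 1
  have h2 := (hasDerivAt_const t (2 : ℝ)).div h1 hN0.ne'
  have h3 := (h2.ofReal_comp).mul h
  have h4 := h3.prodMk (h2.const_sub 1)
  refine ⟨_, h4, ?_⟩
  have hin : |inner ℝ (γ t) γ'| ≤ ‖γ t‖ * ‖γ'‖ := abs_real_inner_le_norm _ _
  have hg : ‖γ t‖ ≤ N := by nlinarith [sq_nonneg (‖γ t‖ - 1)]
  have hd : |(0 * (1 + ‖γ t‖ ^ 2) - 2 * (2 * inner ℝ (γ t) γ')) / (1 + ‖γ t‖ ^ 2) ^ 2|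
      ≤ 4 * (‖γ t‖ * ‖γ'‖) / N ^ 2 := by
    rw [abs_div, ← hN, abs_of_pos (pow_pos hN0 2)]
    gcongr
    rw [zero_mul, zero_sub, abs_neg, abs_mul, abs_mul, abs_two]
    linarith
  rw [Prod.norm_def, max_le_iff]
  constructor
  · refine (norm_add_le _ _).trans ?_
    rw [norm_mul, norm_mul, Complex.norm_real, Real.norm_eq_abs]
    simp only [Pi.div_apply, Complex.norm_real, Real.norm_eq_abs, ← hN] at hd ⊢
    rw [abs_of_pos (div_pos two_pos hN0)]
    calc _ ≤ 4 * (‖γ t‖ * ‖γ'‖) / N ^ 2 * ‖γ t‖ + 2 / N * ‖γ'‖ := by gcongr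
      _ = 4 * ‖γ'‖ / N * (‖γ t‖ ^ 2 / N) + 2 / N * ‖γ'‖ := by field_simp
      _ ≤ 4 * ‖γ'‖ / N * 1 + 2 / N * ‖γ'‖ := by
        gcongr
        rw [div_le_one hN0]; linarith
      _ = _ := by field_simp; ring
  · rw [norm_neg, Real.norm_eq_abs]
    refine hd.trans ?_
    calc 4 * (‖γ t‖ * ‖γ'‖) / N ^ 2 ≤ 4 * (N * ‖γ'‖) / N ^ 2 := by gcongr
      _ = 4 * (‖γ'‖ / N) := by field_simp
      _ ≤ _ := by gcongr; norm_num

/-- A bound on the spherical derivative of a meromorphic function, off a countable set, makes the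
function Lipschitz into the Riemann sphere. -/
lemma norm_stereo_sphereValue_sub_le {f : ℂ → ℂ} (hf : Meromorphic f) {D : Set ℂ}
    (hD : D.Countable) {B : Set ℂ} (hBo : IsOpen B) (hBc : Convex ℝ B) {C : ℝ}
    (h : ∀ z ∈ B, z ∉ D → DifferentiableAt ℂ f z ∧ ‖deriv f z‖ ≤ C * (1 + ‖f z‖ ^ 2))
    {a b : ℂ} (ha : a ∈ B) (hb : b ∈ B) :
    ‖stereo (sphereValue f b) - stereo (sphereValue f a)‖ ≤ 6 * C * ‖b - a‖ := by
  have hcont : Continuous fun z => stereo (sphereValue f z) :=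
    continuous_stereo.comp (continuous_sphereValue hf)
  have hseg : ∀ a ∈ B, a ∉ D → ∀ b ∈ B, (∀ t ∈ Set.Icc (0 : ℝ) 1, a + t * (b - a) ∉ D) →
      ‖stereo (sphereValue f b) - stereo (sphereValue f a)‖ ≤ 6 * C * ‖b - a‖ := by
    intro a ha _ b hb hab
    have hmem : ∀ t ∈ Set.Icc (0 : ℝ) 1, a + t * (b - a) ∈ B := by
      intro t ht
      have := hBc.add_smul_sub_mem ha hb ht
      simpa using this
    have hval : ∀ t ∈ Set.Icc (0 : ℝ) 1,
        sphereValue f (a + t * (b - a)) = f (a + t * (b - a)) := fun t ht =>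
      sphereValue_of_continuousAt (hf _) (h _ (hmem t ht) (hab t ht)).1.continuousAt
    have hder : ∀ t ∈ Set.Icc (0 : ℝ) 1, ∃ v,
        HasDerivAt (fun s : ℝ => stereo (f (a + s * (b - a)))) v t ∧ ‖v‖ ≤ 6 * C * ‖b - a‖ := by
      intro t ht
      obtain ⟨h1, h2⟩ := h _ (hmem t ht) (hab t ht)
      have h3 : HasDerivAt (fun s : ℝ => a + (s : ℂ) * (b - a)) (b - a) t := by
        simpa using ((Complex.ofRealCLM.hasDerivAt (x := t)).mul_const (b - a)).const_add a
      have h4 := h1.hasDerivAt.comp_of_eq t h3 rfl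
      obtain ⟨v, hv, hv'⟩ := exists_hasDerivAt_stereo h4
      refine ⟨v, hv, hv'.trans ?_⟩
      rw [mul_assoc 6]
      gcongr
      rw [div_le_iff₀ (by positivity), norm_mul]
      simp only [Function.comp]
      nlinarith [norm_nonneg (b - a)]
    choose! v hv hv' using hder
    have := norm_image_sub_le_of_norm_deriv_le_segment_01'
      (f := fun s : ℝ => stereo (f (a + s * (b - a)))) (f' := v) (C := 6 * C * ‖b - a‖)
      (fun t ht => (hv t ht).hasDerivWithinAt) (fun t ht => hv' t ⟨ht.1, ht.2.le⟩)
    have e0 := hval 0 (by simp)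
    have e1 := hval 1 (by simp)
    simp only [ofReal_zero, ofReal_one, zero_mul, one_mul, add_zero, add_sub_cancel] at this e0 e1
    rwa [e0, e1]
  -- The estimate is closed in each endpoint because `sphereValue f` is continuous, poles included.
  -- So it extends from visible `b` to all `b`, and then from `a ∉ D` to all `a`.
  have hgood : ∀ a ∈ B, a ∉ D → ∀ b ∈ B,
      ‖stereo (sphereValue f b) - stereo (sphereValue f a)‖ ≤ 6 * C * ‖b - a‖ := by
    intro a ha haD b hb
    have hcl : b ∈ closure (B ∩ {b : ℂ | ∀ t ∈ Set.Icc (0 : ℝ) 1, a + t * (b - a) ∉ D}) :=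
      (dense_setOf_segment_avoids hD haD).open_subset_closure_inter hBo hb
    refine closure_minimal (fun b hb => hseg a ha haD b hb.1 hb.2) ?_ hcl
    exact isClosed_le (hcont.sub continuous_const).norm (by fun_prop)
  have hcl : a ∈ closure (B ∩ Dᶜ) :=
    (dense_compl_of_countable hD).open_subset_closure_inter hBo ha
  refine closure_minimal (fun a ha => hgood a ha.1 ha.2 b hb) ?_ hcl
  exact isClosed_le (continuous_const.sub hcont).norm (by fun_prop)

/-- Locally uniformly Lipschitz sequences of maps into the Riemann sphere have convergent
subsequences. -/
lemma exists_sphericallyTendsto_of_lipschitz {F : ℕ → ℂ → OnePoint ℂ} (C : ℕ → ℝ)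
    (h : ∀ (R n : ℕ), ∀ a ∈ Metric.ball (0 : ℂ) R, ∀ b ∈ Metric.ball (0 : ℂ) R,
      ‖stereo (F n b) - stereo (F n a)‖ ≤ C R * ‖b - a‖) :
    ∃ φ : ℕ → ℕ, StrictMono φ ∧ ∃ G, SphericallyTendsto (fun n => F (φ n)) G := by
  set T : Set (ℂ → ℂ × ℝ) := {g | (∀ z, g z ∈ Set.range stereo) ∧
    ∀ R : ℕ, ∀ a ∈ Metric.ball (0 : ℂ) R, ∀ b ∈ Metric.ball (0 : ℂ) R,
      ‖g b - g a‖ ≤ C R * ‖b - a‖} with hT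
  -- Compactness in the product topology suffices: all conditions defining `T` are pointwise and
  -- closed, and the sphere is compact. Equicontinuity upgrades this to compactness for locally
  -- uniform convergence.
  have hTc : IsCompact T := by
    have hcomp : IsCompact (Set.range stereo) := isCompact_range continuous_stereo
    refine (isCompact_univ_pi fun _ : ℂ => hcomp).of_isClosed_subset ?_ fun g hg z _ => hg.1 z
    simp only [hT, Set.ofPred_and, Set.ofPred_forall]
    refine (isClosed_iInter fun z => hcomp.isClosed.preimage (continuous_apply z)).inter ?_
    refine isClosed_iInter fun R => isClosed_iInter fun a => isClosed_iInter fun _ =>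
      isClosed_iInter fun b => isClosed_iInter fun _ => ?_
    exact isClosed_le ((continuous_apply b).sub (continuous_apply a)).norm continuous_const
  have hTeq : Equicontinuous ((↑) : T → ℂ → ℂ × ℝ) := by
    intro z
    obtain ⟨R, hR⟩ := exists_nat_gt ‖z‖
    have hz : z ∈ Metric.ball (0 : ℂ) R := by simpa using hR
    rw [Metric.equicontinuousAt_iff_right]
    intro ε hε
    have h1 : Tendsto (fun b => C R * ‖b - z‖) (𝓝 z) (𝓝 0) := by
      have : Continuous fun b => C R * ‖b - z‖ := by fun_prop
      simpa using this.tendsto z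
    filter_upwards [h1.eventually_lt_const hε, Metric.isOpen_ball.mem_nhds hz] with b hb hbR g
    rw [dist_comm, dist_eq_norm]
    exact (g.2.2 R z hz b hbR).trans_lt hb
  have hTcont : ∀ g ∈ T, Continuous g := fun g hg => hTeq.continuous ⟨g, hg⟩
  set S : Set C(ℂ, ℂ × ℝ) := {g | (g : ℂ → ℂ × ℝ) ∈ T} with hS
  have himg : ContinuousMap.toFun '' S = T := by
    ext g
    constructor
    · rintro ⟨g, hg, rfl⟩; exact hg
    · intro hg; exact ⟨⟨g, hTcont g hg⟩, hg, rfl⟩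
  have hSc : IsCompact S := by
    refine ArzelaAscoli.isCompact_of_equicontinuous S (himg ▸ hTc) ?_
    exact hTeq.comp (fun g : S => (⟨g.1, g.2⟩ : T))
  have hFT : ∀ n, (fun z => stereo (F n z)) ∈ T := fun n =>
    ⟨fun z => ⟨_, rfl⟩, fun R a ha b hb => h R n a ha b hb⟩
  obtain ⟨g, hg, φ, hφ, hlim⟩ := hSc.tendsto_subseq
    (x := fun n => (⟨_, hTcont _ (hFT n)⟩ : C(ℂ, ℂ × ℝ))) (fun n => hFT n)
  have hg' : ∀ z, ∃ x, stereo x = g z := fun z => hg.1 z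
  choose G hG using hg'
  refine ⟨φ, hφ, G, ?_⟩
  rw [sphericallyTendsto_iff]
  simp only [hG]
  exact ContinuousMap.tendsto_iff_tendstoLocallyUniformly.1 hlim

/-! ### Algebraic estimates from a bound on the modified Hamiltonian. -/

/-- The Hamiltonian of the system `p' = -q² - zp - α`, `q' = p² + zq + β`. -/
noncomputable def hamiltonian (α β z p q : ℂ) : ℂ :=
  (p ^ 3 + q ^ 3) / 3 + z * p * q + α * q + β * p

/-- The Hamiltonian with its polar part removed, at the scale `S`. -/
noncomputable def modHamiltonian (α β : ℂ) (S : ℝ) (z p q : ℂ) : ℂ :=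
  hamiltonian α β z p q - q ^ 2 * conj p / ((S : ℂ) ^ 2 + p * conj p)

lemma sq_add_mul_conj (S : ℝ) (p : ℂ) :
    (S : ℂ) ^ 2 + p * conj p = ((S ^ 2 + ‖p‖ ^ 2 : ℝ) : ℂ) := by
  rw [Complex.mul_conj, Complex.normSq_eq_norm_sq]; push_cast; ring

section Estimates

variable {α β z p q : ℂ} {S : ℝ}

lemma norm_hamiltonian_le (hS : 1 ≤ S) :
    ‖hamiltonian α β z p q‖ ≤
      ‖modHamiltonian α β S z p q‖ + ‖q‖ ^ 2 * (‖p‖ / (S ^ 2 + ‖p‖ ^ 2)) := by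
  have h : hamiltonian α β z p q =
      modHamiltonian α β S z p q + q ^ 2 * conj p / ((S : ℂ) ^ 2 + p * conj p) := by
    simp [modHamiltonian]
  rw [h]
  refine (norm_add_le _ _).trans_eq ?_
  rw [sq_add_mul_conj, norm_div, norm_mul, norm_pow, Complex.norm_real, Complex.norm_conj,
    Real.norm_of_nonneg (by positivity), mul_div_assoc]

lemma norm_modHamiltonian_le (hS : 1 ≤ S) :
    ‖modHamiltonian α β S z p q‖ ≤ ‖hamiltonian α β z p q‖ + ‖q‖ ^ 2 := by
  refine (norm_sub_le _ _).trans ?_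
  rw [sq_add_mul_conj, norm_div, norm_mul, norm_pow, Complex.norm_real, Complex.norm_conj,
    Real.norm_of_nonneg (by positivity), mul_div_assoc]
  gcongr
  refine mul_le_of_le_one_right (by positivity) ?_
  rw [div_le_one (by positivity)]
  nlinarith [sq_nonneg (‖p‖ - 1)]

lemma norm_hamiltonian_le' (hS : 1 ≤ S) (hW : ‖modHamiltonian α β S z p q‖ ≤ S ^ 3) :
    ‖hamiltonian α β z p q‖ ≤ S ^ 3 + ‖q‖ ^ 2 := by
  refine (norm_hamiltonian_le hS).trans (add_le_add hW ?_)
  refine mul_le_of_le_one_right (by positivity) ?_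
  rw [div_le_one (by positivity)]
  nlinarith [sq_nonneg (‖p‖ - 1)]

lemma norm_cube_add_cube_le (hz : ‖z‖ ≤ S) (hα : ‖α‖ ≤ S ^ 2) (hβ : ‖β‖ ≤ S ^ 2) :
    ‖p ^ 3 + q ^ 3‖ ≤ 3 * ‖hamiltonian α β z p q‖ +
      3 * S * ‖p‖ * ‖q‖ + 3 * S ^ 2 * ‖q‖ + 3 * S ^ 2 * ‖p‖ := by
  have h : p ^ 3 + q ^ 3 =
      3 * hamiltonian α β z p q + (-3) * z * p * q + (-3) * α * q + (-3) * β * p := by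
    simp only [hamiltonian]; ring
  rw [h]
  refine norm_add₄_le.trans ?_
  simp only [norm_mul, norm_neg, RCLike.norm_ofNat]
  gcongr

lemma norm_cube_le (a b : ℂ) : ‖a‖ ^ 3 ≤ ‖a ^ 3 + b ^ 3‖ + ‖b‖ ^ 3 := by
  have h := norm_sub_le (a ^ 3 + b ^ 3) (b ^ 3)
  rwa [add_sub_cancel_right, norm_pow, norm_pow] at h

/-- At `x = 6T` the left side is `216 T³` and the right side `154 T³`; beyond that the cubic term
dominates. -/
lemma le_of_cube_le {x T : ℝ} (hT : 0 < T)
    (h : x ^ 3 ≤ 10 * T ^ 3 + 3 * x ^ 2 * T + 6 * T ^ 2 * x) : x ≤ 6 * T := by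
  by_contra! hx
  have h1 : 0 < x - 6 * T := by linarith
  have hx0 : 0 < x := by linarith
  nlinarith [mul_pos h1 (sq_pos_of_pos hx0), mul_pos h1 (mul_pos hx0 hT),
    mul_pos h1 (sq_pos_of_pos hT), pow_pos hT 3]

/-- The relation `p³ + q³ = 3H - 3zpq - 3αq - 3βp` bounds `|q|³` by `|p|³` plus terms of lower
degree in `q`, so `q` cannot exceed `p` and `S` by more than a factor. The number `T` merges both
scales; it is `√(S² + |p|²)`. -/
lemma norm_right_le {T : ℝ} (hS : 1 ≤ S) (hz : ‖z‖ ≤ S) (hα : ‖α‖ ≤ S ^ 2) (hβ : ‖β‖ ≤ S ^ 2)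
    (hW : ‖modHamiltonian α β S z p q‖ ≤ S ^ 3) (hT : 0 ≤ T) (hT2 : T ^ 2 = S ^ 2 + ‖p‖ ^ 2) :
    ‖q‖ ≤ 6 * T := by
  have hST : S ≤ T := abs_le_of_sq_le_sq' (by nlinarith [sq_nonneg ‖p‖]) hT |>.2
  have hpT : ‖p‖ ≤ T := abs_le_of_sq_le_sq' (by nlinarith) hT |>.2
  have hT1 : 1 ≤ T := hS.trans hST
  have h1 := norm_cube_add_cube_le (p := p) (q := q) hz hα hβ
  have h2 : ‖hamiltonian α β z p q‖ ≤ S ^ 3 + ‖q‖ ^ 2 * T := by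
    refine (norm_hamiltonian_le hS).trans (add_le_add hW ?_)
    rw [← hT2]
    gcongr
    rw [div_le_iff₀ (by positivity)]
    nlinarith [pow_pos (zero_lt_one.trans_le hT1) 2, pow_pos (zero_lt_one.trans_le hT1) 3]
  have h3 : ‖q‖ ^ 3 ≤ ‖p ^ 3 + q ^ 3‖ + ‖p‖ ^ 3 := by
    rw [add_comm (p ^ 3)]; exact norm_cube_le q p
  refine le_of_cube_le (by linarith) ?_
  have e1 : S ^ 3 ≤ T ^ 3 := by gcongr
  have e2 : ‖p‖ ^ 3 ≤ T ^ 3 := by gcongr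
  have e3 : S * ‖p‖ * ‖q‖ ≤ T * T * ‖q‖ := by gcongr
  have e4 : S ^ 2 * ‖q‖ ≤ T ^ 2 * ‖q‖ := by gcongr
  have e5 : S ^ 2 * ‖p‖ ≤ T ^ 2 * T := by gcongr
  nlinarith [norm_nonneg q]

lemma norm_left_le {T : ℝ} (hS : 1 ≤ S) (hz : ‖z‖ ≤ S) (hα : ‖α‖ ≤ S ^ 2) (hβ : ‖β‖ ≤ S ^ 2)
    (hW : ‖modHamiltonian α β S z p q‖ ≤ S ^ 3) (hT : 0 ≤ T) (hT2 : T ^ 2 = S ^ 2 + ‖q‖ ^ 2) :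
    ‖p‖ ≤ 6 * T := by
  have hST : S ≤ T := abs_le_of_sq_le_sq' (by nlinarith [sq_nonneg ‖q‖]) hT |>.2
  have hqT : ‖q‖ ≤ T := abs_le_of_sq_le_sq' (by nlinarith) hT |>.2
  have hT1 : 1 ≤ T := hS.trans hST
  have h1 := norm_cube_add_cube_le (p := p) (q := q) hz hα hβ
  have h2 := norm_hamiltonian_le' hS hW
  have h3 : ‖p‖ ^ 3 ≤ ‖p ^ 3 + q ^ 3‖ + ‖q‖ ^ 3 := by
    exact norm_cube_le p q
  refine le_of_cube_le (by linarith) ?_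
  have e1 : S ^ 3 ≤ T ^ 3 := by gcongr
  have e2 : ‖q‖ ^ 3 ≤ T ^ 3 := by gcongr
  have e3 : S * ‖p‖ * ‖q‖ ≤ T * ‖p‖ * T := by gcongr
  have e4 : S ^ 2 * ‖q‖ ≤ T ^ 2 * T := by gcongr
  have e5 : S ^ 2 * ‖p‖ ≤ T ^ 2 * ‖p‖ := by gcongr
  have e6 : ‖q‖ ^ 2 ≤ T ^ 2 * T := by
    calc ‖q‖ ^ 2 ≤ T ^ 2 * 1 := by rw [mul_one]; gcongr
      _ ≤ _ := by gcongr
  have e7 : 0 ≤ ‖p‖ ^ 2 * T := by positivity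
  nlinarith [norm_nonneg p]

lemma norm_vectorField_left_le {T : ℝ} (hS : 1 ≤ S) (hz : ‖z‖ ≤ S) (hα : ‖α‖ ≤ S ^ 2)
    (hβ : ‖β‖ ≤ S ^ 2) (hW : ‖modHamiltonian α β S z p q‖ ≤ S ^ 3) (hT : 0 ≤ T)
    (hT2 : T ^ 2 = S ^ 2 + ‖p‖ ^ 2) : ‖-q ^ 2 - z * p - α‖ ≤ 38 * T ^ 2 := by
  have hq := norm_right_le hS hz hα hβ hW hT hT2
  have hST : S ≤ T := abs_le_of_sq_le_sq' (by nlinarith [sq_nonneg ‖p‖]) hT |>.2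
  have hpT : ‖p‖ ≤ T := abs_le_of_sq_le_sq' (by nlinarith) hT |>.2
  calc _ ≤ ‖q‖ ^ 2 + ‖z‖ * ‖p‖ + ‖α‖ := by
        refine (norm_sub_le _ _).trans (add_le_add_left ((norm_sub_le _ _).trans_eq ?_) _)
        simp
    _ ≤ (6 * T) ^ 2 + T * T + T ^ 2 := by
        gcongr
        · exact hz.trans hST
        · exact hα.trans (by gcongr)
    _ = _ := by ring

lemma norm_vectorField_right_le {T : ℝ} (hS : 1 ≤ S) (hz : ‖z‖ ≤ S) (hα : ‖α‖ ≤ S ^ 2)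
    (hβ : ‖β‖ ≤ S ^ 2) (hW : ‖modHamiltonian α β S z p q‖ ≤ S ^ 3) (hT : 0 ≤ T)
    (hT2 : T ^ 2 = S ^ 2 + ‖q‖ ^ 2) : ‖p ^ 2 + z * q + β‖ ≤ 38 * T ^ 2 := by
  have hp := norm_left_le hS hz hα hβ hW hT hT2
  have hST : S ≤ T := abs_le_of_sq_le_sq' (by nlinarith [sq_nonneg ‖q‖]) hT |>.2
  have hqT : ‖q‖ ≤ T := abs_le_of_sq_le_sq' (by nlinarith) hT |>.2
  calc _ ≤ ‖p‖ ^ 2 + ‖z‖ * ‖q‖ + ‖β‖ := by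
        refine (norm_add₃_le).trans_eq ?_
        simp
    _ ≤ (6 * T) ^ 2 + T * T + T ^ 2 := by
        gcongr
        · exact hz.trans hST
        · exact hβ.trans (by gcongr)
    _ = _ := by ring

lemma three_fourths_le_of_cube {x y : ℝ} (hx : 0 < x) (h : x ^ 3 ≤ x ^ 3 / 2 + y ^ 3)
    (hy : 0 ≤ y) : 3 / 4 * x ≤ y := by
  by_contra! hlt
  have : y ^ 3 ≤ (3 / 4 * x) ^ 3 := by gcongr
  nlinarith [pow_pos hx 3]

/-- For `|p| ≥ 1000 S` the lower-order terms of the cubic relation amount to at most `|p|³/2`, which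
forces `|q| ≥ (3/4)|p|`. Then `q²` dominates the vector field, and `9/16 > 1/2` leaves room for `zp
+ α`. -/
lemma norm_sq_le_vectorField_left (hS : 1 ≤ S) (hz : ‖z‖ ≤ S) (hα : ‖α‖ ≤ S ^ 2)
    (hβ : ‖β‖ ≤ S ^ 2) (hW : ‖modHamiltonian α β S z p q‖ ≤ S ^ 3) (hp : 1000 * S ≤ ‖p‖) :
    ‖p‖ ^ 2 ≤ 2 * ‖-q ^ 2 - z * p - α‖ := by
  have hp0 : 0 < ‖p‖ := by linarith
  set a := ‖p‖ with ha
  have hq : ‖q‖ ≤ 9 * a := by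
    have := norm_right_le hS hz hα hβ hW (Real.sqrt_nonneg _)
      (Real.sq_sqrt (by positivity : 0 ≤ S ^ 2 + ‖p‖ ^ 2))
    refine this.trans ?_
    have h2 : √(S ^ 2 + ‖p‖ ^ 2) ≤ 3 / 2 * a := by
      rw [Real.sqrt_le_left (by positivity)]
      nlinarith
    linarith
  have h1 := norm_cube_add_cube_le (p := p) (q := q) hz hα hβ
  have h2 := norm_hamiltonian_le' hS hW
  have h3 : a ^ 3 ≤ ‖p ^ 3 + q ^ 3‖ + ‖q‖ ^ 3 := by
    exact norm_cube_le p q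
  have hS0 : 0 ≤ S := by linarith
  have hSa : S ≤ a / 1000 := by linarith
  have ha1 : 1 ≤ a / 1000 := by linarith
  have e1 : S ^ 3 ≤ (a / 1000) * a ^ 2 := by
    calc S ^ 3 = S * S ^ 2 := by ring
      _ ≤ (a / 1000) * a ^ 2 := by gcongr; linarith
  have e2 : ‖q‖ ^ 2 ≤ (a / 1000) * (81 * a ^ 2) := by
    calc ‖q‖ ^ 2 ≤ 1 * (9 * a) ^ 2 := by rw [one_mul]; gcongr
      _ ≤ (a / 1000) * (9 * a) ^ 2 := by gcongr
      _ = _ := by ring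
  have e3 : S * a * ‖q‖ ≤ a / 1000 * a * (9 * a) := by gcongr
  have e4 : S ^ 2 * ‖q‖ ≤ (a / 1000) * a * (9 * a) := by
    rw [pow_two]; gcongr; linarith
  have e5 : S ^ 2 * a ≤ (a / 1000) * a * a := by
    rw [pow_two]; gcongr; linarith
  have h4 : 3 / 4 * a ≤ ‖q‖ := by
    refine three_fourths_le_of_cube hp0 ?_ (norm_nonneg q)
    nlinarith [pow_pos hp0 3]
  have h5 : ‖q‖ ^ 2 ≤ ‖-q ^ 2 - z * p - α‖ + ‖z‖ * ‖p‖ + ‖α‖ := by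
    have : q ^ 2 = -(-q ^ 2 - z * p - α) - z * p - α := by ring
    calc ‖q‖ ^ 2 = ‖q ^ 2‖ := by rw [norm_pow]
      _ ≤ _ := by
        conv_lhs => rw [this]
        refine (norm_sub_le _ _).trans (add_le_add_left ((norm_sub_le _ _).trans_eq ?_) _)
        rw [norm_neg, norm_mul]
  have h6 : ‖z‖ * ‖p‖ ≤ a / 1000 * a := by gcongr; exact hz.trans hSa
  have h7 : ‖α‖ ≤ (a / 1000) ^ 2 := hα.trans (by gcongr)
  have h8 : (3 / 4 * a) ^ 2 ≤ ‖q‖ ^ 2 := by gcongr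
  nlinarith [sq_nonneg a]

lemma norm_sq_le_vectorField_right (hS : 1 ≤ S) (hz : ‖z‖ ≤ S) (hα : ‖α‖ ≤ S ^ 2)
    (hβ : ‖β‖ ≤ S ^ 2) (hW : ‖modHamiltonian α β S z p q‖ ≤ S ^ 3) (hq : 1000 * S ≤ ‖q‖) :
    ‖q‖ ^ 2 ≤ 2 * ‖p ^ 2 + z * q + β‖ := by
  have hq0 : 0 < ‖q‖ := by linarith
  set a := ‖q‖ with ha
  have hp : ‖p‖ ≤ 9 * a := by
    have := norm_left_le hS hz hα hβ hW (Real.sqrt_nonneg _)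
      (Real.sq_sqrt (by positivity : 0 ≤ S ^ 2 + ‖q‖ ^ 2))
    refine this.trans ?_
    have h2 : √(S ^ 2 + ‖q‖ ^ 2) ≤ 3 / 2 * a := by
      rw [Real.sqrt_le_left (by positivity)]
      nlinarith
    linarith
  have h1 := norm_cube_add_cube_le (p := p) (q := q) hz hα hβ
  have h2 := norm_hamiltonian_le' hS hW
  have h3 : a ^ 3 ≤ ‖p ^ 3 + q ^ 3‖ + ‖p‖ ^ 3 := by
    rw [add_comm (p ^ 3)]; exact norm_cube_le q p
  have hS0 : 0 ≤ S := by linarith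
  have hSa : S ≤ a / 1000 := by linarith
  have ha1 : 1 ≤ a / 1000 := by linarith
  have e1 : S ^ 3 ≤ (a / 1000) * a ^ 2 := by
    calc S ^ 3 = S * S ^ 2 := by ring
      _ ≤ (a / 1000) * a ^ 2 := by gcongr; linarith
  have e2 : a ^ 2 ≤ (a / 1000) * a ^ 2 := le_mul_of_one_le_left (by positivity) ha1
  have e3 : S * ‖p‖ * a ≤ a / 1000 * (9 * a) * a := by gcongr
  have e4 : S ^ 2 * ‖p‖ ≤ (a / 1000) * a * (9 * a) := by
    rw [pow_two]; gcongr; linarith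
  have e5 : S ^ 2 * a ≤ (a / 1000) * a * a := by
    rw [pow_two]; gcongr; linarith
  have h4 : 3 / 4 * a ≤ ‖p‖ := by
    refine three_fourths_le_of_cube hq0 ?_ (norm_nonneg p)
    nlinarith [pow_pos hq0 3]
  have h5 : ‖p‖ ^ 2 ≤ ‖p ^ 2 + z * q + β‖ + ‖z‖ * ‖q‖ + ‖β‖ := by
    have : p ^ 2 = (p ^ 2 + z * q + β) - z * q - β := by ring
    calc ‖p‖ ^ 2 = ‖p ^ 2‖ := by rw [norm_pow]
      _ ≤ _ := by
        conv_lhs => rw [this]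
        refine (norm_sub_le _ _).trans (add_le_add_left ((norm_sub_le _ _).trans_eq ?_) _)
        rw [norm_mul]
  have h6 : ‖z‖ * ‖q‖ ≤ a / 1000 * a := by gcongr; exact hz.trans hSa
  have h7 : ‖β‖ ≤ (a / 1000) ^ 2 := hβ.trans (by gcongr)
  have h8 : (3 / 4 * a) ^ 2 ≤ ‖p‖ ^ 2 := by gcongr
  nlinarith [sq_nonneg a]

/-- The core of the bootstrap. Of the terms of `W'`, the dangerous `pq` survives only with the
factor `S⁴/T⁴`, where `T² = S² + |p|²`; the others either contain a factor `S²` or are controlled by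
the bounds on `α`, `β` and `H`. -/
lemma exists_hasDerivAt_modHamiltonian {P Q Z : ℝ → ℂ} {v : ℂ} {t : ℝ} (hS : 1 ≤ S)
    (hα : ‖α‖ ≤ S ^ 2) (hβ : ‖β‖ ≤ S ^ 2) (hz : ‖Z t‖ ≤ S) (hZ : HasDerivAt Z v t)
    (hP : HasDerivAt P ((-Q t ^ 2 - Z t * P t - α) * v) t)
    (hQ : HasDerivAt Q ((P t ^ 2 + Z t * Q t + β) * v) t) :
    ∃ w, HasDerivAt (fun s => modHamiltonian α β S (Z s) (P s) (Q s)) w t ∧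
      (‖modHamiltonian α β S (Z t) (P t) (Q t)‖ ≤ S ^ 3 → ‖w‖ ≤ 2300 * S ^ 2 * ‖v‖) := by
  have hPc : HasDerivAt (fun s => conj (P s)) (conj ((-Q t ^ 2 - Z t * P t - α) * v)) t :=
    hP.star
  have hD0 : (S : ℂ) ^ 2 + P t * conj (P t) ≠ 0 := by
    rw [sq_add_mul_conj]
    exact_mod_cast (by positivity : (0 : ℝ) < S ^ 2 + ‖P t‖ ^ 2).ne'
  have hd1 := (hP.mul hPc).const_add ((S : ℂ) ^ 2)
  have hd2 := ((hQ.pow 2).mul hPc).div hd1 hD0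
  have hd3 := (((((hP.pow 3).add (hQ.pow 3)).div_const 3).add ((hZ.mul hP).mul hQ)).add
    (hQ.const_mul α)).add (hP.const_mul β)
  refine ⟨_, hd3.sub hd2, fun hW => ?_⟩
  set p := P t with hp
  set q := Q t with hq'
  set z := Z t with hz'
  set T := √(S ^ 2 + ‖p‖ ^ 2) with hTdef
  have hT0 : 0 ≤ T := Real.sqrt_nonneg _
  have hT2 : T ^ 2 = S ^ 2 + ‖p‖ ^ 2 := Real.sq_sqrt (by positivity)
  have hq := norm_right_le hS hz hα hβ hW hT0 hT2
  have hX := norm_vectorField_left_le hS hz hα hβ hW hT0 hT2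
  have hST : S ≤ T := abs_le_of_sq_le_sq' (by nlinarith [sq_nonneg ‖p‖]) hT0 |>.2
  have hpT : ‖p‖ ≤ T := abs_le_of_sq_le_sq' (by nlinarith) hT0 |>.2
  have hH : ‖hamiltonian α β z p q‖ ≤ S ^ 3 + 36 * T := by
    refine (norm_hamiltonian_le hS).trans (add_le_add hW ?_)
    rw [← hT2]
    calc ‖q‖ ^ 2 * (‖p‖ / T ^ 2) ≤ (6 * T) ^ 2 * (T / T ^ 2) := by gcongr
      _ = 36 * T := by field_simp; ring
  have hDT : (S : ℂ) ^ 2 + p * conj p = (T : ℂ) ^ 2 := by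
    rw [sq_add_mul_conj, ← hT2]; push_cast; rfl
  have hTne : (T : ℂ) ≠ 0 := by
    have : T ≠ 0 := by linarith
    exact_mod_cast this
  -- The derivative cleared of its denominator `T⁴`, with `q³` eliminated in favour of `H`. The
  -- summand outside the factor `v` comes from differentiating `conj p`. The seven bounds below add
  -- up to `2202`.
  have key : ∀ w : ℂ, w * (T : ℂ) ^ 4 = (p * q * S ^ 4 + (-3) * hamiltonian α β z p q * q * conj p ^ 2
        + (-2) * z * q ^ 2 * conj p * S ^ 2 + 2 * α * q ^ 2 * conj p ^ 2 + β * q * conj p * (p * conj p)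
        + (-2) * β * q * conj p * S ^ 2) * v
        + (- q ^ 2 * conj ((-q ^ 2 - z * p - α) * v) * S ^ 2) → ‖w‖ ≤ 2300 * S ^ 2 * ‖v‖ := by
    intro w hw
    have hTpos : 0 < T := by linarith
    have h1 : ‖w‖ * T ^ 4 = ‖w * (T : ℂ) ^ 4‖ := by
      rw [norm_mul, norm_pow, Complex.norm_real, Real.norm_of_nonneg hT0]
    rw [← mul_le_mul_iff_left₀ (pow_pos hTpos 4), h1, hw]
    have hS0 : 0 ≤ S := by linarith
    have hT1 : 1 ≤ T := hS.trans hST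
    have b1 : ‖p * q * (S : ℂ) ^ 4‖ ≤ 6 * (S ^ 2 * T ^ 4) := by
      simp only [norm_mul, norm_pow, Complex.norm_real, Real.norm_of_nonneg hS0]
      calc ‖p‖ * ‖q‖ * S ^ 4 = ‖p‖ * ‖q‖ * (S ^ 2 * S ^ 2) := by ring
        _ ≤ T * (6 * T) * (S ^ 2 * T ^ 2) := by gcongr
        _ = _ := by ring
    have b2 : ‖(-3) * hamiltonian α β z p q * q * conj p ^ 2‖ ≤ 666 * (S ^ 2 * T ^ 4) := by
      simp only [norm_mul, norm_pow, norm_neg, RCLike.norm_ofNat, Complex.norm_conj]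
      calc _ ≤ 3 * (S ^ 3 + 36 * T) * (6 * T) * T ^ 2 := by gcongr
        _ = 18 * (S ^ 2 * S * T ^ 3) + 648 * (1 * T ^ 4) := by ring
        _ ≤ 18 * (S ^ 2 * T * T ^ 3) + 648 * (S ^ 2 * T ^ 4) := by
          gcongr
          exact one_le_pow₀ hS
        _ = _ := by ring
    have b3 : ‖(-2) * z * q ^ 2 * conj p * (S : ℂ) ^ 2‖ ≤ 72 * (S ^ 2 * T ^ 4) := by
      simp only [norm_mul, norm_pow, norm_neg, RCLike.norm_ofNat, Complex.norm_conj,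
        Complex.norm_real, Real.norm_of_nonneg hS0]
      calc _ ≤ 2 * T * (6 * T) ^ 2 * T * S ^ 2 := by gcongr; exact hz.trans hST
        _ = _ := by ring
    have b4 : ‖2 * α * q ^ 2 * conj p ^ 2‖ ≤ 72 * (S ^ 2 * T ^ 4) := by
      simp only [norm_mul, norm_pow, RCLike.norm_ofNat, Complex.norm_conj]
      calc _ ≤ 2 * S ^ 2 * (6 * T) ^ 2 * T ^ 2 := by gcongr
        _ = _ := by ring
    have b5 : ‖β * q * conj p * (p * conj p)‖ ≤ 6 * (S ^ 2 * T ^ 4) := by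
      simp only [norm_mul, Complex.norm_conj]
      calc _ ≤ S ^ 2 * (6 * T) * T * (T * T) := by gcongr
        _ = _ := by ring
    have b6 : ‖(-2) * β * q * conj p * (S : ℂ) ^ 2‖ ≤ 12 * (S ^ 2 * T ^ 4) := by
      simp only [norm_mul, norm_pow, norm_neg, RCLike.norm_ofNat, Complex.norm_conj,
        Complex.norm_real, Real.norm_of_nonneg hS0]
      calc _ ≤ 2 * S ^ 2 * (6 * T) * T * T ^ 2 := by gcongr
        _ = _ := by ring
    have b7 : ‖- q ^ 2 * conj ((-q ^ 2 - z * p - α) * v) * (S : ℂ) ^ 2‖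
        ≤ 1368 * (S ^ 2 * T ^ 4) * ‖v‖ := by
      simp only [norm_mul, norm_pow, norm_neg, Complex.norm_conj,
        Complex.norm_real, Real.norm_of_nonneg hS0]
      calc _ ≤ (6 * T) ^ 2 * (38 * T ^ 2 * ‖v‖) * S ^ 2 := by gcongr
        _ = _ := by ring
    refine (norm_add_le _ _).trans ?_
    rw [norm_mul]
    have b8 := (norm_add_le _ _).trans (add_le_add ((norm_add_le _ _).trans (add_le_add
      ((norm_add_le _ _).trans (add_le_add (norm_add₃_le.trans (add_le_add
        (add_le_add b1 b2) b3)) b4)) b5)) b6)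
    have b9 := mul_le_mul_of_nonneg_right b8 (norm_nonneg v)
    have b10 : 0 ≤ S ^ 2 * T ^ 4 * ‖v‖ := by positivity
    nlinarith
  apply key
  have hSq : (S : ℂ) ^ 2 = (T : ℂ) ^ 2 - p * conj p := by rw [← hDT]; ring
  simp only [Pi.pow_apply, Pi.mul_apply, ← hp, ← hq', ← hz', hDT, hamiltonian]
  have hS4 : (S : ℂ) ^ 4 = ((T : ℂ) ^ 2 - p * conj p) ^ 2 := by rw [← hSq]; ring
  rw [hS4, hSq]
  field_simp
  push_cast
  ring

end Estimates

/-- Off a countable set, a solution is analytic and satisfies the system pointwise. -/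
lemma IsHamiltonianSolution.exists_countable {α β : ℂ} {p q : ℂ → ℂ}
    (h : IsHamiltonianSolution α β p q) :
    ∃ D : Set ℂ, D.Countable ∧ ∀ z ∉ D, AnalyticAt ℂ p z ∧ AnalyticAt ℂ q z ∧
      deriv p z = -q z ^ 2 - z * p z - α ∧ deriv q z = p z ^ 2 + z * q z + β := by
  have h1 : ∀ᶠ z in codiscrete ℂ, deriv p z = -q z ^ 2 - z * p z - α ∧
      deriv q z = p z ^ 2 + z * q z + β := h.deriv_left.and h.deriv_right
  refine ⟨_, (h.meromorphic_left.countable_compl_analyticAt.union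
    h.meromorphic_right.countable_compl_analyticAt).union
      (exists_countable_compl_of_mem_codiscrete h1).2, fun z hz => ?_⟩
  simp only [Set.mem_union, Set.mem_compl_iff, Set.mem_ofPred_eq, not_or, not_not] at hz
  exact ⟨hz.1.1, hz.1.2, hz.2.1, hz.2.2⟩

/-! ### Growth of the modified Hamiltonian along segments. -/

section Growth

variable {α β : ℂ} {p q : ℂ → ℂ} {D : Set ℂ}

lemma norm_modHamiltonian_le_of_segment
    (h : ∀ z ∉ D, HasDerivAt p (-q z ^ 2 - z * p z - α) z ∧
      HasDerivAt q (p z ^ 2 + z * q z + β) z)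
    {S : ℝ} (hS : 1 ≤ S) (hα : ‖α‖ ≤ S ^ 2) (hβ : ‖β‖ ≤ S ^ 2) {a b : ℂ} (ha : ‖a‖ ≤ S)
    (hb : ‖b‖ ≤ S) (hab : ∀ t ∈ Set.Icc (0 : ℝ) 1, a + t * (b - a) ∉ D)
    (h0 : ‖modHamiltonian α β S a (p a) (q a)‖ ≤ S ^ 3 / 2)
    (hlen : 2300 * S ^ 2 * (‖b - a‖ + 1) ≤ S ^ 3 / 2) :
    ‖modHamiltonian α β S b (p b) (q b)‖ ≤ S ^ 3 := by
  set Z : ℝ → ℂ := fun t => a + t * (b - a) with hZdef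
  have hZ : ∀ t, HasDerivAt Z (b - a) t := fun t => by
    simpa [hZdef] using ((Complex.ofRealCLM.hasDerivAt (x := t)).mul_const (b - a)).const_add a
  have hZS : ∀ t ∈ Set.Icc (0 : ℝ) 1, ‖Z t‖ ≤ S := by
    intro t ht
    have := (convex_closedBall (0 : ℂ) S).add_smul_sub_mem (x := a) (y := b)
      (by simpa using ha) (by simpa using hb) ht
    simpa [hZdef] using this
  have hder : ∀ t ∈ Set.Icc (0 : ℝ) 1, ∃ w,
      HasDerivAt (fun s => modHamiltonian α β S (Z s) (p (Z s)) (q (Z s))) w t ∧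
      (‖modHamiltonian α β S (Z t) (p (Z t)) (q (Z t))‖ ≤ S ^ 3 →
        ‖w‖ ≤ 2300 * S ^ 2 * ‖b - a‖) := fun t ht =>
    exists_hasDerivAt_modHamiltonian (P := p ∘ Z) (Q := q ∘ Z) hS hα hβ (hZS t ht) (hZ t)
      ((h _ (hab t ht)).1.comp_of_eq t (hZ t) rfl) ((h _ (hab t ht)).2.comp_of_eq t (hZ t) rfl)
  choose! w hw hw' using hder
  -- The comparison theorem asks for the derivative bound only at times when the norm meets the
  -- barrier, and the barrier stays below `S³`: exactly the situation in which the bootstrap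
  -- estimate is available. The summand `1` in the slope makes the inequality strict even for `b =
  -- a`.
  have key := image_norm_le_of_norm_deriv_right_lt_deriv_boundary'
    (f := fun s => modHamiltonian α β S (Z s) (p (Z s)) (q (Z s))) (f' := w) (a := 0) (b := 1)
    (B := fun t => S ^ 3 / 2 + t * (2300 * S ^ 2 * (‖b - a‖ + 1)))
    (B' := fun _ => 2300 * S ^ 2 * (‖b - a‖ + 1))
    (fun t ht => (hw t ht).continuousAt.continuousWithinAt)
    (fun t ht => (hw t ⟨ht.1, ht.2.le⟩).hasDerivWithinAt)
    (by simpa [hZdef] using h0) (by fun_prop)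
    (fun t _ => by
      simpa using ((hasDerivAt_id t).mul_const (2300 * S ^ 2 * (‖b - a‖ + 1))
        |>.const_add (S ^ 3 / 2)).hasDerivWithinAt)
    (fun t ht heq => by
      have h1 : t * (2300 * S ^ 2 * (‖b - a‖ + 1)) ≤ 1 * (2300 * S ^ 2 * (‖b - a‖ + 1)) := by
        gcongr; exact ht.2.le
      refine (hw' t ⟨ht.1, ht.2.le⟩ (by rw [heq]; linarith)).trans_lt ?_
      have : 0 < S := by linarith
      gcongr
      linarith)
    (Set.right_mem_Icc.2 zero_le_one)
  simp only [hZdef, ofReal_one, one_mul, add_sub_cancel] at key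
  linarith

/-- The growth estimate `H = O(|z|³)` away from the poles. -/
lemma exists_norm_modHamiltonian_le (hD : D.Countable)
    (h : ∀ z ∉ D, HasDerivAt p (-q z ^ 2 - z * p z - α) z ∧
      HasDerivAt q (p z ^ 2 + z * q z + β) z) :
    ∃ L : ℝ, 1 ≤ L ∧ ‖α‖ ≤ L ∧ ‖β‖ ≤ L ∧ ∀ z ∉ D,
      ‖modHamiltonian α β (L * (1 + ‖z‖)) z (p z) (q z)‖ ≤ (L * (1 + ‖z‖)) ^ 3 := by
  obtain ⟨a, ha⟩ := (dense_compl_of_countable hD).nonempty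
  set L := 1 + ‖α‖ + ‖β‖ + 2 * (‖hamiltonian α β a (p a) (q a)‖ + ‖q a‖ ^ 2)
    + 10000 * (2 + ‖a‖) with hL
  have hL0 : 0 ≤ ‖hamiltonian α β a (p a) (q a)‖ + ‖q a‖ ^ 2 := by positivity
  have hL1 : 1 ≤ L := by
    linarith [norm_nonneg α, norm_nonneg β, norm_nonneg a]
  have hαL : ‖α‖ ≤ L := by linarith [norm_nonneg β, norm_nonneg a]
  have hβL : ‖β‖ ≤ L := by linarith [norm_nonneg α, norm_nonneg a]
  have haL : ‖a‖ ≤ L := by linarith [norm_nonneg α, norm_nonneg β, norm_nonneg a]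
  have hHL : 2 * (‖hamiltonian α β a (p a) (q a)‖ + ‖q a‖ ^ 2) ≤ L := by
    linarith [norm_nonneg α, norm_nonneg β, norm_nonneg a]
  have haL' : 10000 * (2 + ‖a‖) ≤ L := by linarith [norm_nonneg α, norm_nonneg β]
  clear_value L
  refine ⟨L, hL1, hαL, hβL, fun z hz => ?_⟩
  -- The scale is fixed by the endpoint and kept constant along the whole segment from `a`.
  set S := L * (1 + ‖z‖) with hS
  have hLS : L ≤ S := by nlinarith [norm_nonneg z]
  have hS1 : 1 ≤ S := hL1.trans hLS
  have hS2 : S ≤ S ^ 2 := by nlinarith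
  have hSz : 10000 * (2 + ‖a‖) * (1 + ‖z‖) ≤ S := by
    rw [hS]; gcongr
  -- The point `z` need not be visible from `a`. A strict violation at `z` persists nearby by
  -- continuity, hence occurs at some visible `b` within distance `1`.
  by_contra! hlt
  have hcont : ContinuousAt (fun b => ‖modHamiltonian α β S b (p b) (q b)‖) z := by
    have h1 := (h z hz).1.continuousAt
    have h2 := (h z hz).2.continuousAt
    refine ContinuousAt.norm (ContinuousAt.sub ?_ (ContinuousAt.div₀ ?_ ?_ ?_))
    · simp only [hamiltonian]; fun_prop
    · exact (h2.pow 2).mul (continuous_conj.continuousAt.comp h1)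
    · exact continuousAt_const.add (h1.mul (continuous_conj.continuousAt.comp h1))
    · rw [sq_add_mul_conj]
      exact_mod_cast (by positivity : (0 : ℝ) < S ^ 2 + ‖p z‖ ^ 2).ne'
  obtain ⟨b, hab, hb⟩ := (dense_setOf_segment_avoids hD ha).inter_nhds_nonempty
    (inter_mem (hcont.eventually_const_lt hlt) (Metric.ball_mem_nhds z one_pos))
  rw [Set.mem_ofPred_eq] at hab
  have hbz : ‖b‖ ≤ ‖z‖ + 1 := by
    have h1 : ‖b - z‖ < 1 := by simpa [dist_eq_norm] using hb.2
    have h2 : ‖b‖ ≤ ‖b - z‖ + ‖z‖ := by simpa using norm_add_le (b - z) z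
    linarith
  have h1 : ‖b - a‖ ≤ ‖b‖ + ‖a‖ := norm_sub_le _ _
  have h2 := norm_nonneg z
  have h3 := norm_nonneg a
  refine absurd (norm_modHamiltonian_le_of_segment h hS1 ?_ ?_ ?_ ?_ hab ?_ ?_) (not_le.2 hb.1)
  · exact hαL.trans (hLS.trans hS2)
  · exact hβL.trans (hLS.trans hS2)
  · exact haL.trans hLS
  · nlinarith
  · refine (norm_modHamiltonian_le hS1).trans ?_
    have : S ^ 2 ≤ S ^ 3 := pow_le_pow_right₀ hS1 (by norm_num)
    linarith
  · have h4 : 4600 * (‖b - a‖ + 1) ≤ S := by nlinarith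
    have h5 : S ^ 2 * (4600 * (‖b - a‖ + 1)) ≤ S ^ 2 * S := by gcongr
    linarith

end Growth

/-! ### Derivative bounds, rescaling, normality and exclusion of the limit infinity. -/

/-- Bounds on the derivative of `f`, off the countable set `D`, from which the normality of the
rescaled family and the absence of infinite limits follow. -/
structure HasYosidaBound (f : ℂ → ℂ) (D : Set ℂ) (L : ℝ) : Prop where
  meromorphic : Meromorphic f
  countable : D.Countable
  one_le : 1 ≤ L
  analyticAt : ∀ z ∉ D, AnalyticAt ℂ f z
  norm_deriv_le : ∀ z ∉ D, ‖deriv f z‖ ≤ L * ((1 + ‖z‖) ^ 2 + ‖f z‖ ^ 2)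
  norm_sq_le : ∀ z ∉ D, L * (1 + ‖z‖) ≤ ‖f z‖ → ‖f z‖ ^ 2 ≤ 2 * ‖deriv f z‖

lemma IsHamiltonianSolution.exists_hasYosidaBound {α β : ℂ} {p q : ℂ → ℂ}
    (h : IsHamiltonianSolution α β p q) :
    ∃ D L, HasYosidaBound p D L ∧ HasYosidaBound q D L := by
  obtain ⟨D, hD, hDz⟩ := h.exists_countable
  have hder : ∀ z ∉ D, HasDerivAt p (-q z ^ 2 - z * p z - α) z ∧
      HasDerivAt q (p z ^ 2 + z * q z + β) z := fun z hz => by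
    obtain ⟨h1, h2, h3, h4⟩ := hDz z hz
    exact ⟨h3 ▸ h1.differentiableAt.hasDerivAt, h4 ▸ h2.differentiableAt.hasDerivAt⟩
  obtain ⟨L, hL, hα, hβ, hW⟩ := exists_norm_modHamiltonian_le hD hder
  have hS : ∀ z : ℂ, 1 ≤ L * (1 + ‖z‖) := fun z => by nlinarith [norm_nonneg z]
  have hSL : ∀ z : ℂ, L ≤ (L * (1 + ‖z‖)) ^ 2 := fun z => by
    have : L ≤ L * (1 + ‖z‖) := by nlinarith [norm_nonneg z]
    nlinarith [hS z]
  have hzS : ∀ z : ℂ, ‖z‖ ≤ L * (1 + ‖z‖) := fun z => by nlinarith [norm_nonneg z]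
  have hle : ∀ z w : ℂ, 38 * ((L * (1 + ‖z‖)) ^ 2 + ‖w‖ ^ 2) ≤
      1000 * L ^ 2 * ((1 + ‖z‖) ^ 2 + ‖w‖ ^ 2) := fun z w => by
    have : 1 ≤ L ^ 2 := one_le_pow₀ hL
    nlinarith [sq_nonneg (L * (1 + ‖z‖)), sq_nonneg ‖w‖]
  have hle' : ∀ z : ℂ, 1000 * (L * (1 + ‖z‖)) ≤ 1000 * L ^ 2 * (1 + ‖z‖) := fun z => by
    have : L ≤ L ^ 2 := by nlinarith
    nlinarith [norm_nonneg z]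
  have hone : 1 ≤ 1000 * L ^ 2 := by nlinarith
  refine ⟨D, 1000 * L ^ 2, ⟨h.meromorphic_left, hD, hone, fun z hz => (hDz z hz).1,
    fun z hz => ?_, fun z hz hf => ?_⟩, ⟨h.meromorphic_right, hD, hone,
    fun z hz => (hDz z hz).2.1, fun z hz => ?_, fun z hz hf => ?_⟩⟩
  · rw [(hDz z hz).2.2.1]
    refine le_trans ?_ (hle z (p z))
    have hsq := Real.sq_sqrt (by positivity : 0 ≤ (L * (1 + ‖z‖)) ^ 2 + ‖p z‖ ^ 2)
    rw [← hsq]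
    exact norm_vectorField_left_le (hS z) (hzS z) (hα.trans (hSL z)) (hβ.trans (hSL z)) (hW z hz)
      (Real.sqrt_nonneg _) hsq
  · rw [(hDz z hz).2.2.1]
    exact norm_sq_le_vectorField_left (hS z) (hzS z) (hα.trans (hSL z)) (hβ.trans (hSL z))
      (hW z hz) ((hle' z).trans hf)
  · rw [(hDz z hz).2.2.2]
    refine le_trans ?_ (hle z (q z))
    have hsq := Real.sq_sqrt (by positivity : 0 ≤ (L * (1 + ‖z‖)) ^ 2 + ‖q z‖ ^ 2)
    rw [← hsq]
    exact norm_vectorField_right_le (hS z) (hzS z) (hα.trans (hSL z)) (hβ.trans (hSL z)) (hW z hz)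
      (Real.sqrt_nonneg _) hsq
  · rw [(hDz z hz).2.2.2]
    exact norm_sq_le_vectorField_right (hS z) (hzS z) (hα.trans (hSL z)) (hβ.trans (hSL z))
      (hW z hz) ((hle' z).trans hf)

lemma rescale_one_one (f : ℂ → ℂ) (κ : ℂ) :
    rescale 1 1 f κ = fun ζ => κ⁻¹ * f (κ + κ⁻¹ * ζ) := by
  ext ζ
  simp [rescale, Complex.cpow_neg_one]

lemma meromorphic_rescale {f : ℂ → ℂ} (hf : Meromorphic f) (κ : ℂ) :
    Meromorphic (rescale 1 1 f κ) := by
  rw [rescale_one_one]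
  intro ζ
  exact (MeromorphicAt.const _ _).mul ((hf _).comp_analyticAt (by fun_prop))

lemma countable_preimage_rescale {D : Set ℂ} (hD : D.Countable) {κ : ℂ} (hκ : κ ≠ 0) :
    {ζ : ℂ | κ + κ⁻¹ * ζ ∈ D}.Countable :=
  hD.preimage_of_injOn (f := fun ζ => κ + κ⁻¹ * ζ) fun a _ b _ hab => by simpa [hκ] using hab

lemma deriv_rescale {f : ℂ → ℂ} {κ ζ : ℂ} (hf : DifferentiableAt ℂ f (κ + κ⁻¹ * ζ)) :
    deriv (rescale 1 1 f κ) ζ = κ⁻¹ ^ 2 * deriv f (κ + κ⁻¹ * ζ) := by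
  rw [rescale_one_one]
  have h1 : HasDerivAt (fun ζ => κ + κ⁻¹ * ζ) κ⁻¹ ζ := by
    simpa using ((hasDerivAt_id ζ).const_mul κ⁻¹).const_add κ
  have h2 := (hf.hasDerivAt.comp ζ h1).const_mul κ⁻¹
  refine h2.deriv.trans ?_
  ring

lemma analyticAt_rescale {f : ℂ → ℂ} {κ ζ : ℂ} (hf : AnalyticAt ℂ f (κ + κ⁻¹ * ζ)) :
    AnalyticAt ℂ (rescale 1 1 f κ) ζ := by
  rw [rescale_one_one]
  exact analyticAt_const.mul (hf.comp_of_eq (f := fun ζ => κ + κ⁻¹ * ζ) (by fun_prop) rfl)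

namespace HasYosidaBound

variable {f : ℂ → ℂ} {D : Set ℂ} {L : ℝ} {κ ζ : ℂ} {R : ℝ}

lemma one_add_norm_le (hκ : 1 < ‖κ‖) (hζ : ‖ζ‖ ≤ R) :
    1 + ‖κ + κ⁻¹ * ζ‖ ≤ ‖κ‖ * (2 + R) := by
  have hR : 0 ≤ R := (norm_nonneg ζ).trans hζ
  have h1 : ‖κ⁻¹‖ ≤ 1 := by rw [norm_inv]; exact inv_le_one_of_one_le₀ hκ.le
  have h2 : ‖κ + κ⁻¹ * ζ‖ ≤ ‖κ‖ + 1 * R := by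
    refine (norm_add_le _ _).trans ?_
    rw [norm_mul]
    gcongr
  nlinarith

lemma norm_deriv_rescale_le (h : HasYosidaBound f D L) (hκ : 1 < ‖κ‖) (hζ : ‖ζ‖ ≤ R)
    (hD : κ + κ⁻¹ * ζ ∉ D) : ‖deriv (rescale 1 1 f κ) ζ‖ ≤
      L * (2 + R) ^ 2 * (1 + ‖rescale 1 1 f κ ζ‖ ^ 2) := by
  have hR : 0 ≤ R := (norm_nonneg ζ).trans hζ
  have hκ0 : 0 < ‖κ‖ := by linarith
  have hL := h.one_le
  rw [deriv_rescale (h.analyticAt _ hD).differentiableAt, norm_mul, norm_pow, norm_inv,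
    inv_pow, inv_mul_le_iff₀ (by positivity)]
  refine (h.norm_deriv_le _ hD).trans ?_
  have h1 := one_add_norm_le hκ hζ
  have h2 : ‖f (κ + κ⁻¹ * ζ)‖ = ‖κ‖ * ‖rescale 1 1 f κ ζ‖ := by
    rw [rescale_one_one]
    simp only [norm_mul, norm_inv]
    field_simp
  rw [h2]
  calc L * ((1 + ‖κ + κ⁻¹ * ζ‖) ^ 2 + (‖κ‖ * ‖rescale 1 1 f κ ζ‖) ^ 2)
      ≤ L * ((‖κ‖ * (2 + R)) ^ 2 + (‖κ‖ * ‖rescale 1 1 f κ ζ‖) ^ 2 * (2 + R) ^ 2) := by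
        gcongr
        refine le_mul_of_one_le_right (by positivity) (one_le_pow₀ (by linarith))
    _ = _ := by ring

lemma norm_rescale_sq_le (h : HasYosidaBound f D L) (hκ : 1 < ‖κ‖) (hζ : ‖ζ‖ ≤ R)
    (hD : κ + κ⁻¹ * ζ ∉ D) (hf : L * (2 + R) ≤ ‖rescale 1 1 f κ ζ‖) :
    ‖rescale 1 1 f κ ζ‖ ^ 2 ≤ 2 * ‖deriv (rescale 1 1 f κ) ζ‖ := by
  have hκ0 : 0 < ‖κ‖ := by linarith
  have hL := h.one_le
  have h1 := one_add_norm_le hκ hζ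
  have h2 : ‖f (κ + κ⁻¹ * ζ)‖ = ‖κ‖ * ‖rescale 1 1 f κ ζ‖ := by
    rw [rescale_one_one]
    simp only [norm_mul, norm_inv]
    field_simp
  have h3 := h.norm_sq_le _ hD (by
    rw [h2]
    calc L * (1 + ‖κ + κ⁻¹ * ζ‖) ≤ L * (‖κ‖ * (2 + R)) := by gcongr
      _ = ‖κ‖ * (L * (2 + R)) := by ring
      _ ≤ _ := by gcongr)
  rw [deriv_rescale (h.analyticAt _ hD).differentiableAt, norm_mul, norm_pow, norm_inv]
  rw [h2, mul_pow] at h3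
  rw [← mul_le_mul_iff_right₀ (pow_pos hκ0 2)]
  refine h3.trans_eq ?_
  field_simp

lemma isNormalFamily (h : HasYosidaBound f D L) :
    IsNormalFamily {g | ∃ κ : ℂ, 1 < ‖κ‖ ∧ g = rescale 1 1 f κ} := by
  intro g hg
  choose κ hκ hgκ using hg
  refine exists_sphericallyTendsto_of_lipschitz (F := fun n => sphereValue (g n)) (fun R => 6 * (L * (2 + R) ^ 2)) ?_
  intro R n a ha b hb
  have hκ0 : κ n ≠ 0 := norm_pos_iff.1 (by linarith [hκ n])
  refine norm_stereo_sphereValue_sub_le (hgκ n ▸ meromorphic_rescale h.meromorphic _)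
    (countable_preimage_rescale h.countable hκ0) Metric.isOpen_ball (convex_ball 0 (R : ℝ))
    (fun z hz hzD => ?_) ha hb
  rw [hgκ n]
  exact ⟨(analyticAt_rescale (h.analyticAt _ hzD)).differentiableAt,
    h.norm_deriv_rescale_le (hκ n) (by simpa using (mem_ball_zero_iff.1 hz).le) hzD⟩

/-- If a limit were `∞`, then `1/g` would be uniformly small on the unit disc for some rescaled `g`,
hence so would its derivative; but that derivative is `-g'/g²`, of modulus at least `1/2` where `g`
is large. -/
lemma limit_ne_infty (h : HasYosidaBound f D L) (κ : ℕ → ℂ) (G : ℂ → OnePoint ℂ)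
    (hκ : Tendsto (fun n => ‖κ n‖) atTop atTop) (hG : IsRescaledLimit 1 1 f κ G) :
    ∃ ζ, G ζ ≠ ∞ := by
  by_contra! hinf
  have hL := h.one_le
  -- `3L` is the threshold `L(2 + R)` of `norm_rescale_sq_le` for `R = 1`; the summand `10` makes
  -- the Cauchy bound `2/M` less than `1/4`.
  set M := 3 * L + 10 with hM
  have hM10 : 10 < M := by linarith
  have hM0 : 0 < M := by linarith
  obtain ⟨n, hn, hκn⟩ := ((hG _ (isCompact_closedBall 0 1) (1 / M) (by positivity)).and
    (hκ.eventually_gt_atTop 1)).exists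
  have hκ0 : κ n ≠ 0 := norm_pos_iff.1 (by linarith)
  set g := rescale 1 1 f (κ n) with hg
  have hgm : Meromorphic g := meromorphic_rescale h.meromorphic _
  set D' := {ζ : ℂ | κ n + (κ n)⁻¹ * ζ ∈ D} with hD'
  have hD'c : D'.Countable := countable_preimage_rescale h.countable hκ0
  have hga : ∀ ζ ∉ D', AnalyticAt ℂ g ζ := fun ζ hζ => analyticAt_rescale (h.analyticAt _ hζ)
  have hgM : ∀ ζ ∈ Metric.ball (0 : ℂ) 1, ζ ∉ D' → M < ‖g ζ‖ := by
    intro ζ hζ hζD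
    have h1 := hn ζ (Metric.ball_subset_closedBall hζ)
    simp only [hinf, ← hg, sphereValue_of_analyticAt (hga ζ hζD), chordalDist] at h1
    rw [div_lt_div_iff₀ (by positivity) hM0, one_mul] at h1
    by_contra! hle
    have h2 : √(1 + ‖g ζ‖ ^ 2) ≤ 2 * M := by
      rw [Real.sqrt_le_left (by positivity)]
      nlinarith [norm_nonneg (g ζ)]
    linarith
  set u : ℂ → ℂ := g⁻¹ with hu
  have hum : Meromorphic u := hgm.inv
  have hg0 : ∀ ζ ∈ Metric.ball (0 : ℂ) 1, ζ ∉ D' → g ζ ≠ 0 := fun ζ hζ hζD =>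
    norm_pos_iff.1 (hM0.trans (hgM ζ hζ hζD))
  have hua : ∀ ζ ∈ Metric.ball (0 : ℂ) 1, ζ ∉ D' → AnalyticAt ℂ u ζ := fun ζ hζ hζD =>
    (hga ζ hζD).inv (hg0 ζ hζ hζD)
  have huM : ∀ ζ ∈ Metric.ball (0 : ℂ) 1, ζ ∉ D' → ‖u ζ‖ ≤ 1 / M := by
    intro ζ hζ hζD
    rw [hu, Pi.inv_apply, norm_inv, ← one_div]
    exact one_div_le_one_div_of_le hM0 (hgM ζ hζ hζD).le
  have hM1 : 1 / M ≤ 1 := by rw [div_le_one hM0]; linarith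
  have hcl : ∀ ζ ∈ Metric.ball (0 : ℂ) 1, ζ ∈ closure (Metric.ball (0 : ℂ) 1 ∩ D'ᶜ) :=
    fun ζ hζ => (dense_compl_of_countable hD'c).open_subset_closure_inter Metric.isOpen_ball hζ
  have huinf : ∀ ζ ∈ Metric.ball (0 : ℂ) 1, sphereValue u ζ ≠ ∞ := by
    intro ζ hζ hinf'
    have hcont : Continuous fun ζ => ‖stereo (sphereValue u ζ) - stereo ∞‖ :=
      ((continuous_stereo.comp (continuous_sphereValue hum)).sub continuous_const).norm
    have : 1 / 2 ≤ ‖stereo (sphereValue u ζ) - stereo ∞‖ := by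
      refine closure_minimal (t := {ζ | 1 / 2 ≤ ‖stereo (sphereValue u ζ) - stereo ∞‖})
        (fun ζ hζ => ?_) (isClosed_le continuous_const hcont) (hcl ζ hζ)
      have h1 := chordalDist_le (sphereValue u ζ) ∞
      rw [Set.mem_ofPred_eq]
      refine le_trans ?_ ((div_le_iff₀' two_pos).2 h1)
      rw [sphereValue_of_analyticAt (hua ζ hζ.1 hζ.2)]
      simp only [chordalDist]
      have h2 : √(1 + ‖u ζ‖ ^ 2) ≤ 2 := by
        rw [Real.sqrt_le_left two_pos.le]
        nlinarith [huM ζ hζ.1 hζ.2, norm_nonneg (u ζ)]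
      have h3 : 0 < √(1 + ‖u ζ‖ ^ 2) := by positivity
      rw [le_div_iff₀ two_pos, le_div_iff₀ h3]
      linarith
    rw [hinf', sub_self, norm_zero] at this
    norm_num at this
  -- The reciprocal `u` may carry wrong values on the exceptional set, in particular at poles of
  -- `g`; `v` is its analytic repair on the whole disc.
  set v : ℂ → ℂ := fun ζ => finPart (sphereValue u ζ) with hv
  have hva : ∀ ζ ∈ Metric.ball (0 : ℂ) 1, AnalyticAt ℂ v ζ := fun ζ hζ =>
    analyticAt_finPart_sphereValue (hum ζ) (huinf ζ hζ)
  have hvu : ∀ ζ ∈ Metric.ball (0 : ℂ) 1, ζ ∉ D' → v =ᶠ[𝓝 ζ] u := by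
    intro ζ hζ hζD
    filter_upwards [(hua ζ hζ hζD).eventually_analyticAt] with w hw
    rw [hv]
    simp only
    rw [sphereValue_of_analyticAt hw, finPart_coe]
  have hvM : ∀ ζ ∈ Metric.ball (0 : ℂ) 1, ‖v ζ‖ ≤ 1 / M := by
    intro ζ hζ
    by_contra! hlt
    have h1 := (hva ζ hζ).continuousAt.norm.eventually_const_lt hlt
    obtain ⟨w, hw1, hw2⟩ := (mem_closure_iff_nhds.1 (hcl ζ hζ)) _ h1
    have h2 := huM w hw2.1 hw2.2
    rw [← (hvu w hw2.1 hw2.2).eq_of_nhds] at h2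
    exact absurd h2 (not_le.2 hw1)
  obtain ⟨ζ, hζD, hζ⟩ := (dense_compl_of_countable hD'c).inter_nhds_nonempty
    (Metric.ball_mem_nhds (0 : ℂ) (by norm_num : (0 : ℝ) < 1 / 4))
  have hζ4 : ‖ζ‖ < 1 / 4 := by simpa using hζ
  have hζ1 : ζ ∈ Metric.ball (0 : ℂ) 1 := by rw [mem_ball_zero_iff]; linarith
  have hsub : ∀ w ∈ Metric.closedBall ζ (1 / 2), w ∈ Metric.ball (0 : ℂ) 1 := by
    intro w hw
    rw [mem_closedBall_iff_norm] at hw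
    rw [mem_ball_zero_iff]
    have : ‖w‖ ≤ ‖w - ζ‖ + ‖ζ‖ := by simpa using norm_add_le (w - ζ) ζ
    linarith
  have hcauchy : ‖deriv v ζ‖ ≤ (1 / M) / (1 / 2) := by
    refine Complex.norm_deriv_le_of_forall_mem_sphere_norm_le (by norm_num) ?_ fun w hw =>
      hvM w (hsub w (Metric.sphere_subset_closedBall hw))
    refine DifferentiableOn.diffContOnCl fun w hw => ?_
    rw [closure_ball _ (by norm_num)] at hw
    exact (hva w (hsub w hw)).differentiableAt.differentiableWithinAt
  have hgd : HasDerivAt g (deriv g ζ) ζ := (hga ζ hζD).differentiableAt.hasDerivAt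
  have hder : deriv v ζ = -deriv g ζ / g ζ ^ 2 := by
    rw [(hvu ζ hζ1 hζD).deriv_eq]
    exact (hgd.inv (hg0 ζ hζ1 hζD)).deriv
  have hgM' := hgM ζ hζ1 hζD
  have hsq := h.norm_rescale_sq_le hκn (mem_ball_zero_iff.1 hζ1).le hζD
    (by rw [← hg]; linarith)
  rw [← hg] at hsq
  rw [hder, norm_div, norm_neg, norm_pow, div_le_iff₀ (by have := hM0.trans hgM'; positivity)]
    at hcauchy
  have hM5 : 1 / M / (1 / 2) < 1 / 4 := by
    rw [div_div, div_lt_div_iff₀ (by positivity) (by norm_num)]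
    linarith
  nlinarith [pow_pos (hM0.trans hgM') 2]

lemma isYosidaNormal (h : HasYosidaBound f D L) : IsYosidaNormal 1 1 f :=
  ⟨h.meromorphic, h.isNormalFamily, h.limit_ne_infty⟩

end HasYosidaBound

/-! ### Inversion of the sphere and comparison with the Euclidean metric. -/

/-- Inversion of the Riemann sphere. -/
noncomputable def sphereInv (x : OnePoint ℂ) : OnePoint ℂ :=
  open Classical in x.elim ((0 : ℂ) : OnePoint ℂ) fun w => if w = 0 then ∞ else ((w⁻¹ : ℂ) : OnePoint ℂ)

@[simp] lemma sphereInv_infty : sphereInv ∞ = ((0 : ℂ) : OnePoint ℂ) := rfl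

@[simp] lemma sphereInv_zero : sphereInv ((0 : ℂ) : OnePoint ℂ) = ∞ := by
  simp [sphereInv]

lemma sphereInv_coe {w : ℂ} (hw : w ≠ 0) : sphereInv w = ((w⁻¹ : ℂ) : OnePoint ℂ) := by
  simp [sphereInv, hw]

lemma sphereInv_eq_infty_iff {x : OnePoint ℂ} : sphereInv x = ∞ ↔ x = ((0 : ℂ) : OnePoint ℂ) := by
  induction x using OnePoint.rec with
  | infty => simp
  | coe w =>
    rcases eq_or_ne w 0 with rfl | hw
    · simp
    · simp [sphereInv_coe hw, hw]

/-- No exception is needed at `0` and `∞`: both sides vanish there, because `finPart ∞ = 0` and `0⁻¹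
= 0`. -/
lemma finPart_sphereInv (x : OnePoint ℂ) : finPart (sphereInv x) = (finPart x)⁻¹ := by
  induction x using OnePoint.rec with
  | infty => simp [finPart]
  | coe w =>
    rcases eq_or_ne w 0 with rfl | hw
    · simp [finPart]
    · simp [sphereInv_coe hw]

lemma stereo_sphereInv (x : OnePoint ℂ) :
    stereo (sphereInv x) = (conj (stereo x).1, -(stereo x).2) := by
  induction x using OnePoint.rec with
  | infty => simp; norm_num
  | coe w =>
    rcases eq_or_ne w 0 with rfl | hw
    · simp; norm_num
    · have h0 : ‖w‖ ≠ 0 := norm_ne_zero_iff.2 hw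
      have h1 : (1 + ‖w‖ ^ 2) ≠ 0 := by positivity
      rw [sphereInv_coe hw, stereo_coe, stereo_coe]
      refine Prod.ext ?_ ?_
      · simp only [map_mul, Complex.conj_ofReal, norm_inv]
        have h2 : w⁻¹ = conj w * ((‖w‖ ^ 2)⁻¹ : ℝ) := by
          rw [Complex.inv_def, Complex.normSq_eq_norm_sq]
        rw [h2, mul_left_comm, ← Complex.ofReal_mul, mul_comm]
        congr 2
        field_simp
        ring
      · simp only [norm_inv]
        field_simp
        ring

lemma continuous_sphereInv : Continuous sphereInv := by
  rw [isClosedEmbedding_stereo.isInducing.continuous_iff]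
  have : stereo ∘ sphereInv = fun x => (conj (stereo x).1, -(stereo x).2) :=
    funext stereo_sphereInv
  rw [this]
  exact (continuous_conj.comp continuous_stereo.fst).prodMk continuous_stereo.snd.neg

/-- In stereographic coordinates inversion is the rotation `(w, t) ↦ (conj w, -t)`. It lets poles of
limit functions be treated as zeros. -/
lemma chordalDist_sphereInv (x y : OnePoint ℂ) :
    chordalDist (sphereInv x) (sphereInv y) = chordalDist x y := by
  rw [← abs_of_nonneg (chordalDist_nonneg (sphereInv x) _), ← abs_of_nonneg (chordalDist_nonneg x y),
    ← sq_eq_sq_iff_abs_eq_abs, chordalDist_sq, chordalDist_sq, stereo_sphereInv, stereo_sphereInv]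
  simp only [Prod.fst_sub, Prod.snd_sub, ← map_sub, Complex.norm_conj]
  congr 2
  rw [← norm_neg]
  congr 1
  ring

lemma SphericallyTendsto.sphereInv {F : ℕ → ℂ → OnePoint ℂ} {G : ℂ → OnePoint ℂ}
    (h : SphericallyTendsto F G) :
    SphericallyTendsto (fun n z => sphereInv (F n z)) (fun z => sphereInv (G z)) := by
  simpa only [SphericallyTendsto, chordalDist_sphereInv] using h

lemma analyticAt_finPart_sphereInv {f : ℂ → ℂ} {z : ℂ} (hf : Meromorphic f)
    (hz : sphereInv (sphereValue f z) ≠ ∞) :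
    AnalyticAt ℂ (fun w => finPart (sphereInv (sphereValue f w))) z := by
  have h0 : sphereValue f z ≠ ((0 : ℂ) : OnePoint ℂ) := fun h => hz (sphereInv_eq_infty_iff.2 h)
  have key : ∀ w, sphereValue f w ≠ ((0 : ℂ) : OnePoint ℂ) →
      sphereValue f⁻¹ w = sphereInv (sphereValue f w) := by
    intro w hw
    refine sphereValue_eq_of_tendsto (hf w).inv ?_
    have h1 := (continuous_sphereInv.tendsto _).comp (tendsto_sphereValue (hf w))
    refine h1.congr' ?_
    filter_upwards [(tendsto_sphereValue (hf w)).eventually_ne hw] with x hx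
    have hx0 : f x ≠ 0 := fun h => hx (by rw [h])
    simp [sphereInv_coe hx0]
  have h1 : AnalyticAt ℂ (fun w => finPart (sphereValue f⁻¹ w)) z :=
    analyticAt_finPart_sphereValue (hf z).inv (by rwa [key z h0])
  refine h1.congr ?_
  filter_upwards [(continuous_sphereValue hf).continuousAt.eventually_ne h0] with w hw
  rw [key w hw]

lemma norm_finPart_le {x : OnePoint ℂ} {δ : ℝ} (hδ : 0 < δ) (h : δ ≤ ‖stereo x - stereo ∞‖) :
    x ≠ ∞ ∧ ‖finPart x‖ ≤ 2 / δ := by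
  have hx : x ≠ ∞ := by rintro rfl; rw [sub_self, norm_zero] at h; linarith
  refine ⟨hx, ?_⟩
  obtain ⟨w, rfl⟩ := OnePoint.ne_infty_iff_exists.1 hx
  have h1 := h.trans (norm_stereo_sub_le w ∞)
  simp only [chordalDist] at h1
  rw [finPart_coe, le_div_iff₀ hδ]
  rw [le_div_iff₀ (by positivity)] at h1
  have h2 : ‖w‖ ≤ √(1 + ‖w‖ ^ 2) := Real.le_sqrt_of_sq_le (by linarith)
  nlinarith

lemma norm_finPart_sub_le {x y : OnePoint ℂ} (hx : x ≠ ∞) (hy : y ≠ ∞) {M : ℝ}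
    (hxM : ‖finPart x‖ ≤ M) (hyM : ‖finPart y‖ ≤ M) :
    ‖finPart x - finPart y‖ ≤ (1 + M ^ 2) * ‖stereo x - stereo y‖ := by
  obtain ⟨z, rfl⟩ := OnePoint.ne_infty_iff_exists.1 hx
  obtain ⟨w, rfl⟩ := OnePoint.ne_infty_iff_exists.1 hy
  have h1 := chordalDist_le z w
  simp only [chordalDist, finPart_coe] at *
  rw [div_le_iff₀ (by positivity)] at h1
  have e1 : √(1 + ‖z‖ ^ 2) ≤ √(1 + M ^ 2) := Real.sqrt_le_sqrt (by gcongr)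
  have e2 : √(1 + ‖w‖ ^ 2) ≤ √(1 + M ^ 2) := Real.sqrt_le_sqrt (by gcongr)
  have e3 : √(1 + ‖z‖ ^ 2) * √(1 + ‖w‖ ^ 2) ≤ 1 + M ^ 2 := by
    calc _ ≤ √(1 + M ^ 2) * √(1 + M ^ 2) := by gcongr
      _ = _ := Real.mul_self_sqrt (by positivity)
  nlinarith [norm_nonneg (stereo z - stereo w)]

/-! ### Spherical limits of meromorphic functions. -/

section Limits

variable {Φ : ℕ → ℂ → OnePoint ℂ} {F : ℂ → OnePoint ℂ}

lemma SphericallyTendsto.continuous (h : SphericallyTendsto Φ F) (hΦ : ∀ n, Continuous (Φ n)) :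
    Continuous F := by
  rw [isClosedEmbedding_stereo.isInducing.continuous_iff]
  exact (sphericallyTendsto_iff.1 h).continuous
    (Frequently.of_forall fun n => continuous_stereo.comp (hΦ n))

/-- Near a point with finite limit value, spherical convergence is uniform convergence. -/
lemma SphericallyTendsto.exists_ball (h : SphericallyTendsto Φ F) (hF : Continuous F) {a : ℂ}
    (ha : F a ≠ ∞) : ∃ r > 0, (∀ ζ ∈ Metric.ball a r, F ζ ≠ ∞) ∧
      (∀ᶠ n in atTop, ∀ ζ ∈ Metric.ball a r, Φ n ζ ≠ ∞) ∧
      TendstoUniformlyOn (fun n ζ => finPart (Φ n ζ)) (fun ζ => finPart (F ζ)) atTop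
        (Metric.ball a r) := by
  obtain ⟨δ, hδ, hδa⟩ : ∃ δ > 0, 2 * δ < ‖stereo (F a) - stereo ∞‖ := by
    have : 0 < ‖stereo (F a) - stereo ∞‖ :=
      norm_pos_iff.2 (sub_ne_zero.2 fun h => ha (stereo_injective h))
    exact ⟨_, by positivity, (by linarith : 2 * (‖stereo (F a) - stereo ∞‖ / 4) < _)⟩
  have hcont : Continuous fun ζ => ‖stereo (F ζ) - stereo ∞‖ :=
    ((continuous_stereo.comp hF).sub continuous_const).norm
  obtain ⟨r, hr, hball⟩ := Metric.eventually_nhds_iff_ball.1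
    (hcont.continuousAt.eventually_const_lt hδa)
  have hloc := (tendstoLocallyUniformly_iff_forall_isCompact.1 (sphericallyTendsto_iff.1 h)
    (Metric.closedBall a r) (isCompact_closedBall _ _)).mono Metric.ball_subset_closedBall
  rw [Metric.tendstoUniformlyOn_iff] at hloc
  have hfar : ∀ᶠ n in atTop, ∀ ζ ∈ Metric.ball a r, δ ≤ ‖stereo (Φ n ζ) - stereo ∞‖ := by
    filter_upwards [hloc δ hδ] with n hn ζ hζ
    have h1 := hn ζ hζ
    rw [dist_eq_norm] at h1
    have h2 := norm_sub_le_norm_sub_add_norm_sub (stereo (F ζ)) (stereo (Φ n ζ)) (stereo ∞)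
    linarith [hball ζ hζ]
  have hFfar : ∀ ζ ∈ Metric.ball a r, δ ≤ ‖stereo (F ζ) - stereo ∞‖ := fun ζ hζ => by
    linarith [hball ζ hζ]
  refine ⟨r, hr, fun ζ hζ => (norm_finPart_le hδ (hFfar ζ hζ)).1, ?_, ?_⟩
  · filter_upwards [hfar] with n hn ζ hζ using (norm_finPart_le hδ (hn ζ hζ)).1
  · rw [Metric.tendstoUniformlyOn_iff]
    intro ε hε
    set N := 1 + (2 / δ) ^ 2
    have hN : 0 < N := by positivity
    filter_upwards [hfar, hloc (ε / N) (by positivity)] with n hn hn' ζ hζ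
    have h1 := norm_finPart_le hδ (hFfar ζ hζ)
    have h2 := norm_finPart_le hδ (hn ζ hζ)
    rw [dist_eq_norm]
    refine (norm_finPart_sub_le h1.1 h2.1 h1.2 h2.2).trans_lt ?_
    have h3 := hn' ζ hζ
    rw [dist_eq_norm, lt_div_iff₀ hN] at h3
    linarith

lemma SphericallyTendsto.analyticAt_finPart (h : SphericallyTendsto Φ F) (hF : Continuous F)
    (hΦ : ∀ n ζ, Φ n ζ ≠ ∞ → AnalyticAt ℂ (fun w => finPart (Φ n w)) ζ) {a : ℂ} (ha : F a ≠ ∞) :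
    AnalyticAt ℂ (fun w => finPart (F w)) a := by
  obtain ⟨r, hr, -, h1, h2⟩ := h.exists_ball hF ha
  refine DifferentiableOn.analyticAt (s := Metric.ball a r) ?_ (Metric.ball_mem_nhds a hr)
  refine h2.tendstoLocallyUniformlyOn.differentiableOn ?_ Metric.isOpen_ball
  filter_upwards [h1] with n hn ζ hζ using
    (hΦ n ζ (hn ζ hζ)).differentiableAt.differentiableWithinAt

variable {f : ℕ → ℂ → ℂ}

/-- A spherical limit of meromorphic functions is locally `∞` or has isolated poles. -/
lemma SphericallyTendsto.eventually_infty_or (h : SphericallyTendsto (fun n => sphereValue (f n)) F)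
    (hf : ∀ n, Meromorphic (f n)) (a : ℂ) : (∀ᶠ z in 𝓝 a, F z = ∞) ∨
      (MeromorphicAt (fun z => finPart (F z)) a ∧ ∀ᶠ z in 𝓝[≠] a, F z ≠ ∞) := by
  have hF := h.continuous fun n => continuous_sphereValue (hf n)
  by_cases ha : F a = ∞
  · have hinv : Continuous fun z => _root_.sphereInv (F z) := continuous_sphereInv.comp hF
    have ha' : _root_.sphereInv (F a) ≠ ∞ := by rw [ha]; simp
    have han := h.sphereInv.analyticAt_finPart hinv
      (fun n ζ => analyticAt_finPart_sphereInv (hf n)) ha'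
    simp only [finPart_sphereInv] at han
    have hne : ∀ᶠ z in 𝓝 a, F z ≠ ((0 : ℂ) : OnePoint ℂ) := by
      filter_upwards [hinv.continuousAt.eventually_ne ha'] with z hz h0
      exact hz (sphereInv_eq_infty_iff.2 h0)
    -- The analytic function is the reciprocal of the finite part, and it vanishes exactly where `F`
    -- is `0` or `∞`; the value `0` has just been excluded near `a`. So isolation of zeros gives the
    -- dichotomy.
    rcases han.eventually_eq_zero_or_eventually_ne_zero with h0 | h0
    · left
      filter_upwards [h0, hne] with z hz hz'
      by_contra hzi
      refine hz' ?_
      rw [← coe_finPart hzi, inv_eq_zero.1 hz]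
    · right
      refine ⟨?_, ?_⟩
      · have := han.meromorphicAt.inv
        refine this.congr (Eventually.of_forall fun z => ?_)
        simp
      · filter_upwards [h0] with z hz hzi
        simp [hzi, finPart] at hz
  · right
    exact ⟨(h.analyticAt_finPart hF (fun n ζ hζ => analyticAt_finPart_sphereValue (hf n ζ) hζ)
      ha).meromorphicAt, (hF.continuousAt.eventually_ne ha).filter_mono nhdsWithin_le_nhds⟩

lemma SphericallyTendsto.meromorphic (h : SphericallyTendsto (fun n => sphereValue (f n)) F)
    (hf : ∀ n, Meromorphic (f n)) (hne : ∃ ζ, F ζ ≠ ∞) :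
    Meromorphic (fun z => finPart (F z)) ∧ (∀ᶠ z in codiscrete ℂ, F z ≠ ∞) ∧
      F = sphereValue fun z => finPart (F z) := by
  have hF := h.continuous fun n => continuous_sphereValue (hf n)
  have hdich := h.eventually_infty_or hf
  -- The plane is connected, so being locally `∞` at one point would mean being `∞` everywhere.
  have hclopen : IsClopen {a | ∀ᶠ z in 𝓝 a, F z = ∞} := by
    refine ⟨isOpen_compl_iff.1 (isOpen_iff_mem_nhds.2 fun a ha => ?_),
      isOpen_iff_mem_nhds.2 fun a ha => ha.eventually_nhds⟩
    have h1 := ((hdich a).resolve_left ha).2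
    rw [eventually_nhdsWithin_iff] at h1
    filter_upwards [h1] with b hb hb'
    rcases eq_or_ne b a with rfl | hba
    · exact ha hb'
    · exact hb hba hb'.self_of_nhds
  have hgood : ∀ a, MeromorphicAt (fun z => finPart (F z)) a ∧ ∀ᶠ z in 𝓝[≠] a, F z ≠ ∞ := by
    rcases isClopen_iff.1 hclopen with hA | hA
    · exact fun a => (hdich a).resolve_left fun ha => by
        have : a ∈ ({a | ∀ᶠ z in 𝓝 a, F z = ∞} : Set ℂ) := ha
        simp [hA] at this
    · obtain ⟨ζ, hζ⟩ := hne
      have : ζ ∈ ({a | ∀ᶠ z in 𝓝 a, F z = ∞} : Set ℂ) := by simp [hA]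
      exact absurd this.self_of_nhds hζ
  refine ⟨fun a => (hgood a).1, ?_, ?_⟩
  · refine mem_codiscreteWithin_iff_forall_mem_nhdsNE.2 fun a _ => ?_
    rw [Set.compl_univ, Set.union_empty]
    exact (hgood a).2
  · ext1 a
    symm
    refine sphereValue_eq_of_tendsto (hgood a).1 ?_
    refine (hF.tendsto a |>.mono_left nhdsWithin_le_nhds).congr' ?_
    filter_upwards [(hgood a).2] with z hz using (coe_finPart hz).symm

end Limits

/-! ### The autonomous system satisfied by limit pairs. -/

section LimitSystem

variable {α β : ℂ} {p q : ℂ → ℂ} {κ : ℕ → ℂ} {F G : ℂ → OnePoint ℂ}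

lemma SphericallyTendsto.tendsto_deriv {f : ℕ → ℂ → ℂ} (hf : ∀ n, Meromorphic (f n))
    (h : SphericallyTendsto (fun n => sphereValue (f n)) F) {a : ℂ} (ha : F a ≠ ∞)
    (hfa : ∀ᶠ n in atTop, AnalyticAt ℂ (f n) a) :
    AnalyticAt ℂ (fun z => finPart (F z)) a ∧
      Tendsto (fun n => f n a) atTop (𝓝 (finPart (F a))) ∧
      Tendsto (fun n => deriv (f n) a) atTop (𝓝 (deriv (fun z => finPart (F z)) a)) := by
  have hF := h.continuous fun n => continuous_sphereValue (hf n)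
  obtain ⟨r, hr, -, h1, h2⟩ := h.exists_ball hF ha
  have ha' := Metric.mem_ball_self (x := a) hr
  have hloc := h2.tendstoLocallyUniformlyOn
  have hdiff : ∀ᶠ n in atTop, DifferentiableOn ℂ (fun ζ => finPart (sphereValue (f n) ζ))
      (Metric.ball a r) := by
    filter_upwards [h1] with n hn ζ hζ using
      (analyticAt_finPart_sphereValue (hf n ζ) (hn ζ hζ)).differentiableAt.differentiableWithinAt
  have heq : ∀ᶠ n in atTop, (fun ζ => finPart (sphereValue (f n) ζ)) =ᶠ[𝓝 a] f n := by
    filter_upwards [hfa] with n hn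
    filter_upwards [hn.eventually_analyticAt] with w hw
    rw [sphereValue_of_analyticAt hw, finPart_coe]
  refine ⟨h.analyticAt_finPart hF (fun n ζ hζ => analyticAt_finPart_sphereValue (hf n ζ) hζ) ha,
    ?_, ?_⟩
  · refine (h2.tendsto_at ha').congr' ?_
    filter_upwards [heq] with n hn using hn.eq_of_nhds
  · refine ((hloc.deriv hdiff Metric.isOpen_ball).tendsto_at ha').congr' ?_
    filter_upwards [heq] with n hn using hn.deriv_eq

lemma tendsto_inv_sq (hκ : Tendsto (fun n => ‖κ n‖) atTop atTop) :
    Tendsto (fun n => (κ n)⁻¹ ^ 2) atTop (𝓝 0) := by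
  have := (tendsto_inv₀_cobounded.comp (tendsto_norm_atTop_iff_cobounded.1 hκ)).pow 2
  simpa using this

lemma IsHamiltonianSolution.exists_countable_limit (h : IsHamiltonianSolution α β p q)
    (hκ : Tendsto (fun n => ‖κ n‖) atTop atTop) (hF : IsRescaledLimit 1 1 p κ F)
    (hG : IsRescaledLimit 1 1 q κ G) :
    ∃ E : Set ℂ, E.Countable ∧ ∀ a ∉ E, F a ≠ ∞ → G a ≠ ∞ →
      deriv (fun z => finPart (F z)) a = -finPart (G a) ^ 2 - finPart (F a) ∧
      deriv (fun z => finPart (G z)) a = finPart (F a) ^ 2 + finPart (G a) := by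
  obtain ⟨D, hD, hDz⟩ := h.exists_countable
  -- For `κ n = 0` the substitution is constant and the preimage of `D` could be the whole plane;
  -- such `n` are finitely many and play no role in the limit.
  refine ⟨⋃ n, {ζ | κ n ≠ 0 ∧ κ n + (κ n)⁻¹ * ζ ∈ D}, Set.countable_iUnion fun n => ?_,
    fun a ha hFa hGa => ?_⟩
  · by_cases hn : κ n = 0
    · simp [hn]
    · exact (countable_preimage_rescale hD hn).mono fun ζ hζ => hζ.2
  · have hκ0 : ∀ᶠ n in atTop, κ n ≠ 0 := by
      filter_upwards [hκ.eventually_gt_atTop 0] with n hn using norm_pos_iff.1 hn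
    have haD : ∀ᶠ n in atTop, κ n ≠ 0 ∧ κ n + (κ n)⁻¹ * a ∉ D := by
      filter_upwards [hκ0] with n hn
      exact ⟨hn, fun hmem => ha (Set.mem_iUnion.2 ⟨n, hn, hmem⟩)⟩
    obtain ⟨-, hp, hp'⟩ := SphericallyTendsto.tendsto_deriv
      (fun n => meromorphic_rescale h.meromorphic_left (κ n)) hF hFa
      (haD.mono fun n hn => analyticAt_rescale (hDz _ hn.2).1)
    obtain ⟨-, hq, hq'⟩ := SphericallyTendsto.tendsto_deriv
      (fun n => meromorphic_rescale h.meromorphic_right (κ n)) hG hGa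
      (haD.mono fun n hn => analyticAt_rescale (hDz _ hn.2).2.1)
    have hk := tendsto_inv_sq hκ
    constructor
    -- With `z = κ + κ⁻¹a` one has `κ⁻²·z·p(z) = (1 + κ⁻²a)·p_κ(a)`, so the coefficient of the
    -- linear term tends to `1` and the constant `κ⁻²α` to `0`.
    · have hlim := (((hq.pow 2).neg).sub (((hk.mul_const a).const_add 1).mul hp)).sub
        (hk.mul_const α)
      refine tendsto_nhds_unique hp' ((hlim.congr' ?_).trans (by simp))
      filter_upwards [haD] with n hn
      have hn0 := hn.1
      rw [deriv_rescale (hDz _ hn.2).1.differentiableAt, (hDz _ hn.2).2.2.1, rescale_one_one,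
        rescale_one_one]
      field_simp
    · have hlim := ((hp.pow 2).add (((hk.mul_const a).const_add 1).mul hq)).add
        (hk.mul_const β)
      refine tendsto_nhds_unique hq' ((hlim.congr' ?_).trans (by simp))
      filter_upwards [haD] with n hn
      have hn0 := hn.1
      rw [deriv_rescale (hDz _ hn.2).2.1.differentiableAt, (hDz _ hn.2).2.2.2, rescale_one_one,
        rescale_one_one]
      field_simp

/-- Continuous functions agreeing off a countable set agree. -/
lemma eq_of_eqOn_compl_countable {f g : ℂ → ℂ} {E V : Set ℂ} (hE : E.Countable) (hV : IsOpen V)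
    (h : ∀ z ∈ V, z ∉ E → f z = g z) {a : ℂ} (ha : a ∈ V) (hf : ContinuousAt f a)
    (hg : ContinuousAt g a) : f a = g a := by
  by_contra hne
  obtain ⟨b, hbE, hb, hbV⟩ := (dense_compl_of_countable hE).inter_nhds_nonempty
    (inter_mem ((hf.sub hg).eventually_ne (sub_ne_zero.2 hne)) (hV.mem_nhds ha))
  exact hb (sub_eq_zero.2 (h b hbV hbE))

theorem IsHamiltonianSolution.exists_isLimitSolution (h : IsHamiltonianSolution α β p q)
    (hκ : Tendsto (fun n => ‖κ n‖) atTop atTop) (hF : IsRescaledLimit 1 1 p κ F)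
    (hG : IsRescaledLimit 1 1 q κ G) :
    ∃ (c : ℂ) (P Q : ℂ → ℂ), F = sphereValue P ∧ G = sphereValue Q ∧ IsLimitSolution c P Q := by
  obtain ⟨D, L, hp, hq⟩ := h.exists_hasYosidaBound
  have hmp := fun n => meromorphic_rescale h.meromorphic_left (κ n)
  have hmq := fun n => meromorphic_rescale h.meromorphic_right (κ n)
  obtain ⟨hP, hP', hFP⟩ := SphericallyTendsto.meromorphic hF hmp (hp.limit_ne_infty κ F hκ hF)
  obtain ⟨hQ, hQ', hGQ⟩ := SphericallyTendsto.meromorphic hG hmq (hq.limit_ne_infty κ G hκ hG)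
  have hFc := SphericallyTendsto.continuous hF fun n => continuous_sphereValue (hmp n)
  have hGc := SphericallyTendsto.continuous hG fun n => continuous_sphereValue (hmq n)
  set P := fun z => finPart (F z) with hPdef
  set Q := fun z => finPart (G z) with hQdef
  obtain ⟨E, hE, hEz⟩ := h.exists_countable_limit hκ hF hG
  set V : Set ℂ := {z | F z ≠ ∞ ∧ G z ≠ ∞} with hVdef
  have hVcod : V ∈ codiscrete ℂ := hP'.and hQ'
  obtain ⟨hVo, hVc⟩ := exists_countable_compl_of_mem_codiscrete hVcod
  have hPa : ∀ z ∈ V, AnalyticAt ℂ P z := fun z hz =>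
    SphericallyTendsto.analyticAt_finPart hF hFc
      (fun n ζ hζ => analyticAt_finPart_sphereValue (hmp n ζ) hζ) hz.1
  have hQa : ∀ z ∈ V, AnalyticAt ℂ Q z := fun z hz =>
    SphericallyTendsto.analyticAt_finPart hG hGc
      (fun n ζ hζ => analyticAt_finPart_sphereValue (hmq n ζ) hζ) hz.2
  have hdP : ∀ z ∈ V, deriv P z = -Q z ^ 2 - P z := fun z hz =>
    eq_of_eqOn_compl_countable (g := fun z => -Q z ^ 2 - P z) hE hVo
      (fun z hz hzE => (hEz z hzE hz.1 hz.2).1) hz (hPa z hz).deriv.continuousAt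
      (((hQa z hz).continuousAt.pow 2).neg.sub (hPa z hz).continuousAt)
  have hdQ : ∀ z ∈ V, deriv Q z = P z ^ 2 + Q z := fun z hz =>
    eq_of_eqOn_compl_countable (g := fun z => P z ^ 2 + Q z) hE hVo
      (fun z hz hzE => (hEz z hzE hz.1 hz.2).2) hz (hQa z hz).deriv.continuousAt
      (((hPa z hz).continuousAt.pow 2).add (hQa z hz).continuousAt)
  set J := fun z => (P z ^ 3 + Q z ^ 3) / 3 + P z * Q z with hJ
  have hJd : ∀ z ∈ V, HasDerivAt J 0 z := by
    intro z hz
    have h1 : HasDerivAt P (-Q z ^ 2 - P z) z := hdP z hz ▸ (hPa z hz).differentiableAt.hasDerivAt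
    have h2 : HasDerivAt Q (P z ^ 2 + Q z) z := hdQ z hz ▸ (hQa z hz).differentiableAt.hasDerivAt
    have h3 := (((h1.pow 3).add (h2.pow 3)).div_const 3).add (h1.mul h2)
    refine h3.congr_deriv ?_
    push_cast
    ring
  -- Removing a countable set from a real vector space of dimension greater than `1` does not
  -- disconnect it; this is what makes the first integral a single constant.
  have hVconn : IsConnected V := by
    have := hVc.isConnected_compl_of_one_lt_rank (by simp [Complex.rank_real_complex])
    rwa [compl_compl] at this
  obtain ⟨a, ha⟩ := hVconn.nonempty
  refine ⟨J a, P, Q, hFP, hGQ, hP, hQ, ?_, ?_, ?_⟩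
  · filter_upwards [hVcod] with z hz using hdP z hz
  · filter_upwards [hVcod] with z hz using hdQ z hz
  · filter_upwards [hVcod] with z hz
    exact hVo.is_const_of_deriv_eq_zero hVconn.isPreconnected
      (fun w hw => (hJd w hw).differentiableAt.differentiableWithinAt)
      (fun w hw => (hJd w hw).deriv) hz ha

end LimitSystem

/-! ### A rationality criterion. -/

lemma exists_norm_eval_le (A : Polynomial ℂ) :
    ∃ (C : ℝ) (N : ℕ), 0 ≤ C ∧ ∀ z : ℂ, ‖A.eval z‖ ≤ C * (1 + ‖z‖) ^ N := by
  induction A using Polynomial.induction_on' with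
  | add A B hA hB =>
    obtain ⟨C, N, hC, hA⟩ := hA
    obtain ⟨C', N', hC', hB⟩ := hB
    refine ⟨C + C', N + N', by positivity, fun z => ?_⟩
    have h1 : (1 : ℝ) ≤ 1 + ‖z‖ := by linarith [norm_nonneg z]
    rw [Polynomial.eval_add, add_mul]
    refine (norm_add_le _ _).trans (add_le_add ((hA z).trans ?_) ((hB z).trans ?_)) <;> gcongr <;>
      first | exact h1 | omega
  | monomial n a =>
    refine ⟨‖a‖, n, norm_nonneg a, fun z => ?_⟩
    rw [Polynomial.eval_monomial, norm_mul, norm_pow]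
    gcongr
    linarith

/-- An entire function of polynomial growth is a polynomial. -/
lemma exists_polynomial_of_norm_le {v : ℂ → ℂ} (hv : Differentiable ℂ v) {C R₀ : ℝ} {N : ℕ}
    (hC : 0 ≤ C) (h : ∀ z : ℂ, R₀ ≤ ‖z‖ → ‖v z‖ ≤ C * (1 + ‖z‖) ^ N) :
    ∃ A : Polynomial ℂ, ∀ z, v z = A.eval z := by
  -- Cauchy's estimate on circles of radius `R → ∞` kills every Taylor coefficient of order above
  -- `N`.
  have hzero : ∀ n, N < n → iteratedDeriv n v 0 = 0 := by
    intro n hn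
    have hb : ∀ R : ℝ, max R₀ 1 ≤ R →
        ‖iteratedDeriv n v 0‖ ≤ n.factorial * (C * 2 ^ N) * R⁻¹ := by
      intro R hR
      have hR1 : 1 ≤ R := (le_max_right _ _).trans hR
      have hR0 : 0 < R := by linarith
      have h1 := Complex.norm_iteratedDeriv_le_of_forall_mem_sphere_norm_le (c := 0) n hR0
        hv.diffContOnCl (C := C * (2 * R) ^ N) (fun z hz => by
          rw [mem_sphere_zero_iff_norm] at hz
          refine (h z (by rw [hz]; exact (le_max_left _ _).trans hR)).trans ?_
          rw [hz]
          gcongr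
          linarith)
      refine h1.trans ?_
      rw [div_le_iff₀ (by positivity), mul_pow]
      have h2 : R ^ N * R ≤ R ^ n := by
        rw [← pow_succ]
        exact pow_le_pow_right₀ hR1 hn
      have h3 : R ^ N ≤ R⁻¹ * R ^ n := by
        rw [inv_mul_eq_div, le_div_iff₀ hR0]
        exact h2
      calc n.factorial * (C * (2 ^ N * R ^ N)) ≤ n.factorial * (C * (2 ^ N * (R⁻¹ * R ^ n))) := by
            gcongr
        _ = _ := by ring
    have hlim : Tendsto (fun R : ℝ => n.factorial * (C * 2 ^ N) * R⁻¹) atTop (𝓝 0) := by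
      simpa using tendsto_inv_atTop_zero.const_mul ((n.factorial : ℝ) * (C * 2 ^ N))
    have := ge_of_tendsto hlim ((eventually_ge_atTop _).mono hb)
    exact norm_le_zero_iff.1 this
  refine ⟨∑ n ∈ Finset.range (N + 1),
    Polynomial.C ((n.factorial : ℂ)⁻¹ * iteratedDeriv n v 0) * Polynomial.X ^ n, fun z => ?_⟩
  have hs := Complex.hasSum_taylorSeries_of_entire hv 0 z
  have hfin : ∀ n ∉ Finset.range (N + 1),
      ((n.factorial : ℂ)⁻¹ • (z - 0) ^ n • iteratedDeriv n v 0) = 0 := by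
    intro n hn
    rw [hzero n (by simpa using hn)]
    simp
  rw [hs.unique (hasSum_sum_of_ne_finset_zero hfin), Polynomial.eval_finsetSum]
  refine Finset.sum_congr rfl fun n _ => ?_
  simp
  ring

lemma sphereValue_eq_of_eventuallyEq {f g : ℂ → ℂ} {z : ℂ} (hg : AnalyticAt ℂ g z)
    (h : f =ᶠ[𝓝[≠] z] g) : sphereValue f z = g z := by
  rw [← sphereValue_of_analyticAt hg]
  exact (sphereValue_congr hg.meromorphicAt h.symm).symm

lemma finite_setOf_sphereValue_eq_infty {f : ℂ → ℂ} (hf : Meromorphic f) {R₀ : ℝ}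
    (h : ∀ z : ℂ, R₀ ≤ ‖z‖ → sphereValue f z ≠ ∞) : {z | sphereValue f z = ∞}.Finite := by
  have h1 : {z | sphereValue f z ≠ ∞} ∈ codiscrete ℂ := by
    refine mem_codiscreteWithin_iff_forall_mem_nhdsNE.2 fun a _ => ?_
    rw [Set.compl_univ, Set.union_empty]
    filter_upwards [eventually_sphereValue_eq (hf a)] with w hw
    simp [hw]
  refine ((isCompact_closedBall (0 : ℂ) R₀).finite_sdiff_of_mem_codiscreteWithin
    (codiscreteWithin_mono (Set.subset_univ _) h1)).subset fun z hz => ⟨?_, fun h => h hz⟩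
  rw [mem_closedBall_zero_iff]
  by_contra! hlt
  exact h z hlt.le hz

/-- A meromorphic function without large poles and of linear growth is rational. -/
lemma isRationalFunction_of_norm_le {f : ℂ → ℂ} (hf : Meromorphic f) {C R₀ : ℝ} (hC : 0 ≤ C)
    (h : ∀ z : ℂ, R₀ ≤ ‖z‖ → sphereValue f z ≠ ∞ ∧ ‖finPart (sphereValue f z)‖ ≤ C * ‖z‖) :
    IsRationalFunction f := by
  have hfin := finite_setOf_sphereValue_eq_infty hf fun z hz => (h z hz).1
  have hf' := hf
  choose m hm using hf'
  -- The exponent `m d` is any one for which `(w - d) ^ m d • f w` is analytic at `d`, so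
  -- multiplying `f` by `B` removes all its finitely many poles.
  set B : Polynomial ℂ := ∏ d ∈ hfin.toFinset, (Polynomial.X - Polynomial.C d) ^ m d with hB
  have hB0 : B ≠ 0 := Finset.prod_ne_zero_iff.2 fun d _ => pow_ne_zero _ (Polynomial.X_sub_C_ne_zero d)
  have hBa : ∀ z, AnalyticAt ℂ (fun w => B.eval w) z := fun z =>
    (B.differentiable.analyticAt z)
  set g : ℂ → ℂ := fun z => B.eval z * f z with hg
  have hgm : Meromorphic g := fun z => (hBa z).meromorphicAt.mul (hf z)
  have hfa : ∀ z, sphereValue f z ≠ ∞ →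
      sphereValue g z = (B.eval z * finPart (sphereValue f z) : ℂ) := by
    intro z hz
    refine sphereValue_eq_of_eventuallyEq
      (g := fun w => B.eval w * finPart (sphereValue f w))
      ((hBa z).mul (analyticAt_finPart_sphereValue (hf z) hz)) ?_
    filter_upwards [eventually_sphereValue_eq (hf z)] with w hw
    rw [hw, finPart_coe]
  have hgfin : ∀ z, sphereValue g z ≠ ∞ := by
    intro z
    by_cases hz : sphereValue f z = ∞
    · have hzm : z ∈ hfin.toFinset := by simpa using hz
      have hBz : B = (∏ d ∈ hfin.toFinset.erase z, (Polynomial.X - Polynomial.C d) ^ m d) *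
          (Polynomial.X - Polynomial.C z) ^ m z := by
        rw [hB, Finset.prod_erase_mul _ _ hzm]
      set B' := ∏ d ∈ hfin.toFinset.erase z, (Polynomial.X - Polynomial.C d) ^ m d
      rw [sphereValue_eq_of_eventuallyEq
        (g := fun w => B'.eval w * ((w - z) ^ m z • f w))
        ((B'.differentiable.analyticAt z).mul (hm z)) (Eventually.of_forall fun w => by
          simp [hg, hBz, mul_assoc])]
      exact OnePoint.coe_ne_infty _
    · rw [hfa z hz]
      exact OnePoint.coe_ne_infty _
  set v : ℂ → ℂ := fun z => finPart (sphereValue g z) with hv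
  have hvd : Differentiable ℂ v := fun z =>
    (analyticAt_finPart_sphereValue (hgm z) (hgfin z)).differentiableAt
  obtain ⟨C', N, hC', hBC⟩ := exists_norm_eval_le B
  obtain ⟨A, hA⟩ := exists_polynomial_of_norm_le hvd (C := C' * C) (R₀ := R₀) (N := N + 1)
    (by positivity) (fun z hz => by
      rw [hv]
      simp only
      rw [hfa z (h z hz).1, finPart_coe, norm_mul]
      calc _ ≤ C' * (1 + ‖z‖) ^ N * (C * (1 + ‖z‖)) := by
            gcongr
            · exact hBC z
            · refine (h z hz).2.trans ?_
              gcongr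
              linarith
        _ = _ := by ring)
  refine ⟨A, B, hB0, ?_⟩
  have hBne : ∀ᶠ z in codiscrete ℂ, B.eval z ≠ 0 := by
    have := (Polynomial.finite_setOfPred_isRoot hB0).compl_mem_codiscrete
    filter_upwards [this] with z hz using hz
  have hval : ∀ᶠ z in codiscrete ℂ, sphereValue g z = g z := by
    refine mem_codiscreteWithin_iff_forall_mem_nhdsNE.2 fun a _ => ?_
    rw [Set.compl_univ, Set.union_empty]
    exact eventually_sphereValue_eq (hgm a)
  filter_upwards [hBne, hval] with z hz1 hz2
  rw [← hA z, hv]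
  simp only
  rw [hz2, finPart_coe, hg, eq_div_iff hz1, mul_comm]

/-- This is `f(κ) = κ·f_κ(0)` at the level of sphere values: behaviour of limit functions at the
origin alone governs the growth of `f`. -/
lemma sphereValue_of_rescale {f : ℂ → ℂ} (hf : Meromorphic f) {κ : ℂ} (hκ : κ ≠ 0)
    (h : sphereValue (rescale 1 1 f κ) 0 ≠ ∞) :
    sphereValue f κ = ((κ * finPart (sphereValue (rescale 1 1 f κ) 0) : ℂ) : OnePoint ℂ) := by
  have hg := meromorphic_rescale hf κ
  have ha := analyticAt_finPart_sphereValue (hg 0) h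
  set v := fun w => finPart (sphereValue (rescale 1 1 f κ) w) with hv
  have ha' : AnalyticAt ℂ (fun w => κ * v (κ * (w - κ))) κ :=
    analyticAt_const.mul (ha.comp_of_eq (f := fun w => κ * (w - κ)) (by fun_prop) (by simp))
  have := sphereValue_eq_of_eventuallyEq (f := f) ha' ?_
  · simpa using this
  · have hmap : Tendsto (fun w => κ * (w - κ)) (𝓝[≠] κ) (𝓝[≠] 0) := by
      refine tendsto_nhdsWithin_iff.2 ⟨?_, ?_⟩
      · have hc : Continuous fun w => κ * (w - κ) := by fun_prop
        simpa using (hc.tendsto κ).mono_left (nhdsWithin_le_nhds (s := {κ}ᶜ))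
      · filter_upwards [self_mem_nhdsWithin] with w hw
        exact mul_ne_zero hκ (sub_ne_zero.2 hw)
    filter_upwards [hmap.eventually (eventually_sphereValue_eq (hg 0))] with w hw
    rw [hv]
    simp only
    rw [hw, finPart_coe, rescale_one_one]
    simp only
    rw [inv_mul_cancel_left₀ hκ, mul_inv_cancel_left₀ hκ, add_sub_cancel]

lemma IsNormalFamily.exists_isRescaledLimit {f : ℂ → ℂ}
    (h : IsNormalFamily {g | ∃ κ : ℂ, 1 < ‖κ‖ ∧ g = rescale 1 1 f κ}) {κ : ℕ → ℂ}
    (hκ : Tendsto (fun n => ‖κ n‖) atTop atTop) :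
    ∃ φ : ℕ → ℕ, StrictMono φ ∧ ∃ F, IsRescaledLimit 1 1 f (κ ∘ φ) F := by
  -- The family contains only rescalings with `|κ| > 1`, so an initial piece of the sequence is
  -- dropped.
  obtain ⟨N, hN⟩ := eventually_atTop.1 (hκ.eventually_gt_atTop 1)
  obtain ⟨φ, hφ, F, hF⟩ := h (fun n => rescale 1 1 f (κ (n + N)))
    fun n => ⟨_, hN _ (Nat.le_add_left _ _), rfl⟩
  exact ⟨fun n => φ n + N, fun a b hab => Nat.add_lt_add_right (hφ hab) N, F, hF⟩

lemma IsRescaledLimit.comp {f : ℂ → ℂ} {κ : ℕ → ℂ} {F : ℂ → OnePoint ℂ} {a b : ℝ}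
    (h : IsRescaledLimit a b f κ F) {φ : ℕ → ℕ} (hφ : StrictMono φ) :
    IsRescaledLimit a b f (κ ∘ φ) F := fun K hK ε hε =>
  hφ.tendsto_atTop.eventually (h K hK ε hε)

/-- If no limit function of `f` has a pole at the origin, then `f` is rational. -/
lemma IsYosidaNormal.isRationalFunction {f : ℂ → ℂ} (hf : IsYosidaNormal 1 1 f)
    (h : ∀ (κ : ℕ → ℂ) (F : ℂ → OnePoint ℂ), Tendsto (fun n => ‖κ n‖) atTop atTop →
      IsRescaledLimit 1 1 f κ F → F 0 ≠ ∞) : IsRationalFunction f := by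
  by_contra hrat
  -- If linear growth fails with every constant, there are points tending to infinity at which `f`
  -- has a pole or `|f(z)| > n|z|`. Rescaling at these points yields values at the origin that are
  -- infinite or unbounded, against `F 0 ≠ ∞`.
  have hbad : ∀ n : ℕ, ∃ z : ℂ, (n : ℝ) + 1 ≤ ‖z‖ ∧
      (sphereValue f z ≠ ∞ → n * ‖z‖ < ‖finPart (sphereValue f z)‖) := by
    intro n
    by_contra! hcon
    exact hrat (isRationalFunction_of_norm_le hf.meromorphic (Nat.cast_nonneg n) hcon)
  choose κ hκ1 hκ2 using hbad
  have hκ : Tendsto (fun n => ‖κ n‖) atTop atTop :=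
    tendsto_atTop_mono hκ1 (tendsto_atTop_add_const_right _ _ tendsto_natCast_atTop_atTop)
  obtain ⟨φ, hφ, F, hF⟩ := hf.normal.exists_isRescaledLimit hκ
  have hF0 := h _ F (hκ.comp hφ.tendsto_atTop) hF
  have hFc := SphericallyTendsto.continuous hF fun n =>
    continuous_sphereValue (meromorphic_rescale hf.meromorphic _)
  obtain ⟨r, hr, -, h1, h2⟩ := SphericallyTendsto.exists_ball hF hFc hF0
  have h0 := Metric.mem_ball_self (x := (0 : ℂ)) hr
  have h3 := (h2.tendsto_at h0).norm.eventually_lt_const (lt_add_one _)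
  have h4 := (tendsto_natCast_atTop_atTop (R := ℝ)).comp hφ.tendsto_atTop |>.eventually_gt_atTop
    (‖finPart (F 0)‖ + 1)
  obtain ⟨n, hn1, hn3, hn4⟩ := (h1.and (h3.and h4)).exists
  have hn1' := hn1 0 h0
  simp only [Function.comp] at hn1' hn3 hn4
  have hκpos : 0 < ‖κ (φ n)‖ := by
    have := hκ1 (φ n)
    have h5 : (0 : ℝ) ≤ (φ n : ℝ) := Nat.cast_nonneg _
    linarith
  have hval := sphereValue_of_rescale hf.meromorphic (norm_pos_iff.1 hκpos) hn1'
  have h5 := hκ2 (φ n) (by rw [hval]; exact OnePoint.coe_ne_infty _)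
  rw [hval, finPart_coe, norm_mul, mul_comm] at h5
  have h6 := lt_of_mul_lt_mul_left h5 hκpos.le
  linarith

/-- A function with constant square is bounded off a discrete set, so it has no pole. -/
lemma sphereValue_ne_infty_of_sq_eq {Q : ℂ → ℂ} {c : ℂ}
    (h : (fun z => Q z ^ 2) =ᶠ[codiscrete ℂ] fun _ => c) (z : ℂ) : sphereValue Q z ≠ ∞ := by
  intro hz
  have hord : meromorphicOrderAt Q z < 0 := by
    by_contra hord
    simp [sphereValue, hord] at hz
  have h1 := tendsto_norm_atTop_iff_cobounded.2 (tendsto_cobounded_of_meromorphicOrderAt_neg hord)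
  have h2 : ∀ᶠ w in 𝓝[≠] z, Q w ^ 2 = c := by
    have := mem_codiscreteWithin_iff_forall_mem_nhdsNE.1 h z (Set.mem_univ z)
    rw [Set.compl_univ, Set.union_empty] at this
    exact this
  obtain ⟨w, hw1, hw2⟩ := (h2.and (h1.eventually_gt_atTop (1 + ‖c‖))).exists
  have h3 : ‖Q w‖ ^ 2 = ‖c‖ := by rw [← norm_pow, hw1]
  nlinarith [norm_nonneg c]

lemma eventually_const_of_sphereValue {P : ℂ → ℂ} (hP : Meromorphic P) {c : ℂ}
    (h : ∀ z, sphereValue P z = c) : ∀ᶠ z in codiscrete ℂ, P z = c ∧ deriv P z = 0 := by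
  refine mem_codiscreteWithin_iff_forall_mem_nhdsNE.2 fun a _ => ?_
  rw [Set.compl_univ, Set.union_empty]
  filter_upwards [(hP a).eventually_analyticAt] with z hz
  have h1 : P =ᶠ[𝓝 z] fun _ => c := by
    filter_upwards [hz.eventually_analyticAt] with w hw
    have := h w
    rw [sphereValue_of_analyticAt hw] at this
    exact OnePoint.coe_injective this
  exact ⟨h1.eq_of_nhds, by rw [h1.deriv_eq, deriv_const]⟩

/-! ### Non-constant limits for non-rational solutions, and the theorem. -/

section Nonconstant

variable {α β : ℂ} {p q : ℂ → ℂ}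

lemma exists_coe_of_constant {F : ℂ → OnePoint ℂ} (hF : ∃ ζ, F ζ ≠ ∞)
    (h : ∀ ζ₁ ζ₂, F ζ₁ = F ζ₂) : ∃ c : ℂ, ∀ ζ, F ζ = c := by
  obtain ⟨ζ, hζ⟩ := hF
  exact ⟨finPart (F ζ), fun w => by rw [coe_finPart hζ, h w ζ]⟩

theorem IsHamiltonianSolution.isYosidaBar (h : IsHamiltonianSolution α β p q)
    (hrat : ¬ (IsRationalFunction p ∧ IsRationalFunction q)) :
    IsYosidaBar 1 1 p ∧ IsYosidaBar 1 1 q := by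
  obtain ⟨D, L, hp', hq'⟩ := h.exists_hasYosidaBound
  have hp := hp'.isYosidaNormal
  have hq := hq'.isYosidaNormal
  refine ⟨⟨hp, ?_⟩, ⟨hq, ?_⟩⟩
  · by_contra! hcon
    refine hrat ⟨hp.isRationalFunction fun κ F hκ hF => ?_,
      hq.isRationalFunction fun κ G hκ hG => ?_⟩
    · obtain ⟨c, hc⟩ := exists_coe_of_constant (hp.limit_ne_infty κ F hκ hF) (hcon κ F hκ hF)
      simp [hc]
    -- A limit of `q` alone is given; normality of `p` supplies a companion limit along a
    -- subsequence, which is constant by assumption. The first equation then reads `0 = -Q² - c`.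
    · obtain ⟨φ, hφ, F, hF⟩ := hp.normal.exists_isRescaledLimit hκ
      have hκφ := hκ.comp hφ.tendsto_atTop
      obtain ⟨c, hc⟩ := exists_coe_of_constant (hp.limit_ne_infty _ F hκφ hF) (hcon _ F hκφ hF)
      obtain ⟨_, P, Q, rfl, rfl, hPQ⟩ := h.exists_isLimitSolution hκφ hF (hG.comp hφ)
      refine sphereValue_ne_infty_of_sq_eq (c := -c) ?_ 0
      filter_upwards [eventually_const_of_sphereValue hPQ.meromorphic_left hc, hPQ.deriv_left]
        with z hz1 hz2
      rw [hz1.1, hz1.2] at hz2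
      linear_combination hz2
  · by_contra! hcon
    refine hrat ⟨hp.isRationalFunction fun κ F hκ hF => ?_,
      hq.isRationalFunction fun κ G hκ hG => ?_⟩
    · obtain ⟨φ, hφ, G, hG⟩ := hq.normal.exists_isRescaledLimit hκ
      have hκφ := hκ.comp hφ.tendsto_atTop
      obtain ⟨c, hc⟩ := exists_coe_of_constant (hq.limit_ne_infty _ G hκφ hG) (hcon _ G hκφ hG)
      obtain ⟨_, P, Q, rfl, rfl, hPQ⟩ := h.exists_isLimitSolution hκφ (hF.comp hφ) hG
      refine sphereValue_ne_infty_of_sq_eq (c := -c) ?_ 0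
      filter_upwards [eventually_const_of_sphereValue hPQ.meromorphic_right hc, hPQ.deriv_right]
        with z hz1 hz2
      rw [hz1.1, hz1.2] at hz2
      linear_combination -hz2
    · obtain ⟨c, hc⟩ := exists_coe_of_constant (hq.limit_ne_infty κ G hκ hG) (hcon κ G hκ hG)
      simp [hc]

end Nonconstant

theorem mainTheorem10 (α β : ℂ) (p q : ℂ → ℂ) (hpq : IsHamiltonianSolution α β p q) :
    IsYosidaNormal 1 1 p ∧ IsYosidaNormal 1 1 q ∧
    (¬ (IsRationalFunction p ∧ IsRationalFunction q) → IsYosidaBar 1 1 p ∧ IsYosidaBar 1 1 q) ∧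
    ∀ (κ : ℕ → ℂ) (F G : ℂ → OnePoint ℂ), Tendsto (fun n => ‖κ n‖) atTop atTop →
      IsRescaledLimit 1 1 p κ F → IsRescaledLimit 1 1 q κ G →
      ∃ (c : ℂ) (P Q : ℂ → ℂ), F = sphereValue P ∧ G = sphereValue Q ∧
        IsLimitSolution c P Q := by
  obtain ⟨D, L, hp, hq⟩ := hpq.exists_hasYosidaBound
  exact ⟨hp.isYosidaNormal, hq.isYosidaNormal, hpq.isYosidaBar,
    fun κ F G hκ hF hG => hpq.exists_isLimitSolution hκ hF hG⟩
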